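/- Let $H$ be a separable complex Hilbert space, let $SF(H)$ be the set of (possibly unbounded) selfadjoint operators $D$ on $H$ whose bounded transform $D(1+D^2)^{-1/2}$ is a Fredholm operator, and let $\phi:\mathbb R\to\mathbb R$ be an even $C^\infty$ function with $\operatorname{supp}\phi=[-1,1]$ and $\phi'>0$ on $(-1,0)$. For an integer $n\ge 1$ put $\phi_n(x)=\phi(nx)$ and let $\mathfrak{SF}_n(H)$ be the set of $D\in SF(H)$ with $\phi_n(D)$ compact, endowed with the weakest topology for which the maps $D\mapsto (D+i)^{-1}x\in H$ and $D\mapsto(D-i)^{-1}x\in H$, for all $x\in H$, and $D\mapsto\phi_n(D)\in B(H)$ (with the operator norm on $B(H)$) are continuous. Let $\mathfrak{SF}(H)$ be the set $SF(H)$ with the inductive limit topology: a set is open if and only if its intersection with $\mathfrak{SF}_n(H)$ is open in $\mathfrak{SF}_n(H)$ for every $n\ge1$. Spectral flow. Let $(D_t)_{t\in[a,b]}$, $a\le b$, be a continuous path in $\mathfrak{SF}(H)$. Call $\mu>0$ admissible for an interval $[u,v]\subset[a,b]$ if there is an $n\ge1$ with $\mu<\frac1n$ such that $(D_t)_{t\in[u,v]}$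 is a continuous path in $\mathfrak{SF}_n(H)$, and if for all $t\in[u,v]$ both $\mu$ and $-\mu$ belong to the resolvent set of $D_t$ and $1_{[-\mu,\mu]}(D_t)$ has finite-dimensional range. Choose a subdivision $a=\tau_0\le\tau_1\le\dots\le\tau_k=b$ and, for each $i<k$, a number $\mu_i$ admissible for $[\tau_i,\tau_{i+1}]$, and put $$\operatorname{spfl}((D_t)_{t\in[a,b]})=\sum_{i=0}^{k-1}\Big(\dim\operatorname{Ran}1_{[0,\mu_i]}(D_{\tau_{i+1}})-\dim\operatorname{Ran}1_{[0,\mu_i]}(D_{\tau_i})\Big).$$ Proposition. (a) The spectral flow is well defined: for every continuous path in $\mathfrak{SF}(H)$ such a subdivision with admissible $\mu_i$ exists, and the integer on the right does not depend on the choices. (b) If $(D_{(s,t)})_{(s,t)\in[0,1]\times[a,b]}$ is a continuous family in $\mathfrak{SF}(H)$, then $$\operatorname{spfl}((D_{(0,t)})_{t\in[a,b]})+\operatorname{spfl}((D_{(s,b)})_{s\in[0,1]})-\operatorname{spfl}((D_{(1,t)})_{t\in[a,b]})-\operatorname{spfl}((D_{(s,a)})_{s\in[0,1]})=0.$$ (c)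 Consequently, if in addition either $D_{(s,a)}$ and $D_{(s,b)}$ are invertible (with bounded inverse) for all $s\in[0,1]$, or $D_{(s,a)}=D_{(s,b)}$ for all $s\in[0,1]$, then $$\operatorname{spfl}((D_{(0,t)})_{t\in[a,b]})=\operatorname{spfl}((D_{(1,t)})_{t\in[a,b]}).$$ -/

import Mathlib

open Set Topology
open scoped ContDiff

noncomputable section

namespace SpectralFlow

/-- A cutoff function: an even smooth real function with support `[-1, 1]` that is strictly
increasing on `(-1, 0)` in the sense that its derivative is positive there. -/
structure IsCutoff (φ : ℝ → ℝ) : Prop where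
  smooth : ContDiff ℝ ∞ φ
  even : ∀ x, φ (-x) = φ x
  tsupport_eq : tsupport φ = Icc (-1) 1
  deriv_pos : ∀ x ∈ Ioo (-1 : ℝ) 0, 0 < deriv φ x

/-- The set `S(H)` of (possibly unbounded, densely defined) selfadjoint operators on `H`. -/
structure SelfAdjointOp (H : Type*) [NormedAddCommGroup H] [InnerProductSpace ℂ H]
    [CompleteSpace H] where
  /-- the underlying operator, defined on a (dense) subspace of `H` -/
  op : H →ₗ.[ℂ] H
  selfAdjoint : IsSelfAdjoint op

variable {H : Type*} [NormedAddCommGroup H] [InnerProductSpace ℂ H] [CompleteSpace H]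

namespace SelfAdjointOp

/-- The bounded operator `R` is the two-sided inverse of `D - z : dom D → H`. -/
def IsResolvent (D : SelfAdjointOp H) (z : ℂ) (R : H →L[ℂ] H) : Prop :=
  (∀ x : H, ∃ h : R x ∈ D.op.domain, D.op ⟨R x, h⟩ - z • R x = x) ∧
    ∀ y : D.op.domain, R (D.op y - z • (y : H)) = y

/-- `z` lies in the resolvent set of `D`: the operator `D - z` has a bounded inverse. -/
def InResolventSet (D : SelfAdjointOp H) (z : ℂ) : Prop :=
  ∃ R : H →L[ℂ] H, D.IsResolvent z R

/-- `D` is invertible, with bounded inverse. -/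
def IsInvertible (D : SelfAdjointOp H) : Prop := D.InResolventSet 0

open Classical in
/-- The resolvent `(D - z)⁻¹`, for `z` in the resolvent set of `D` (and `0` otherwise).
Since `D` is selfadjoint, every non-real `z` lies in the resolvent set. -/
def resolvent (D : SelfAdjointOp H) (z : ℂ) : H →L[ℂ] H :=
  if h : D.InResolventSet z then h.choose else 0

/-- The operator `f(D)` for a continuous function `f : ℝ → ℝ` vanishing at infinity.
It is the continuous functional calculus of the bounded normal operator `R = (D + i)⁻¹`, applied to
the function that takes the value `f x` at the point `z = 1 / (x + i)` (so that `x = Re (1 / z)`)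
and the value `0` at `z = 0`; the spectrum of `R` consists of the points `1 / (x + i)` with `x` in
the spectrum of `D`, and possibly `0`. -/
def funcCalc (D : SelfAdjointOp H) (f : ℝ → ℝ) : H →L[ℂ] H :=
  cfc (fun z : ℂ => if z = 0 then 0 else ((f (z⁻¹).re : ℝ) : ℂ)) (D.resolvent (-Complex.I))

/-- `F` is the bounded transform `D (1 + D* D)^(-1/2) = D (1 + D²)^(-1/2)` of `D`. -/
def IsBoundedTransform (D : SelfAdjointOp H) (F : H →L[ℂ] H) : Prop :=
  ∀ x : H, ∃ h : D.funcCalc (fun t => (Real.sqrt (1 + t ^ 2))⁻¹) x ∈ D.op.domain,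
    D.op ⟨D.funcCalc (fun t => (Real.sqrt (1 + t ^ 2))⁻¹) x, h⟩ = F x

/-- `D` is Fredholm: its bounded transform is a Fredholm operator. -/
def IsFredholm (D : SelfAdjointOp H) : Prop :=
  ∃ F : H →L[ℂ] H, D.IsBoundedTransform F ∧ F.IsFredholm

/-- The operator `φ_n(D)`, where `φ_n(x) = φ(n x)`. -/
def cutoffOp (φ : ℝ → ℝ) (n : ℕ+) (D : SelfAdjointOp H) : H →L[ℂ] H :=
  D.funcCalc fun x => φ ((n : ℝ) * x)

/-- The range of the spectral projection `1_[α, β](D)`. The projection is the strong limit (the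
infimum) of the operators `f(D)` with `f` continuous, compactly supported and equal to `1` on
`[α, β]`, and its range consists of the vectors that are fixed by all of these operators. -/
def spectralSubspace (D : SelfAdjointOp H) (α β : ℝ) : Submodule ℂ H where
  carrier := {x | ∀ f : ℝ → ℝ, Continuous f → HasCompactSupport f → (∀ t ∈ Icc α β, f t = 1) →
    D.funcCalc f x = x}
  add_mem' := fun hx hy f h1 h2 h3 => by rw [map_add, hx f h1 h2 h3, hy f h1 h2 h3]
  zero_mem' := fun f _ _ _ => map_zero _
  smul_mem' := fun c x hx f h1 h2 h3 => by rw [map_smul, hx f h1 h2 h3]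

/-- The topology of `𝔖_n(H)` on the set of selfadjoint operators: the weakest one for which
`D ↦ (D + i)⁻¹ x` and `D ↦ (D - i)⁻¹ x`, for every `x`, and `D ↦ φ_n(D)`, with the operator norm on
the target, are continuous. -/
@[reducible]
def levelTopology (φ : ℝ → ℝ) (n : ℕ+) : TopologicalSpace (SelfAdjointOp H) :=
  (⨅ x : H, TopologicalSpace.induced
      (fun D : SelfAdjointOp H => D.resolvent (-Complex.I) x) inferInstance) ⊓
    (⨅ x : H, TopologicalSpace.induced
      (fun D : SelfAdjointOp H => D.resolvent Complex.I x) inferInstance) ⊓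
    TopologicalSpace.induced (fun D : SelfAdjointOp H => D.cutoffOp φ n) inferInstance

end SelfAdjointOp

/-- The set `SF_n(H)` of the selfadjoint Fredholm operators `D` such that `φ_n(D)` is compact,
with the subspace topology of `𝔖_n(H)`. -/
def FredholmLevel (φ : ℝ → ℝ) (n : ℕ+) (H : Type*) [NormedAddCommGroup H] [InnerProductSpace ℂ H]
    [CompleteSpace H] : Type _ :=
  {D : SelfAdjointOp H // D.IsFredholm ∧ IsCompactOperator (D.cutoffOp φ n)}

instance (φ : ℝ → ℝ) (n : ℕ+) : TopologicalSpace (FredholmLevel φ n H) :=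
  TopologicalSpace.induced Subtype.val (SelfAdjointOp.levelTopology φ n)

/-- The space `𝔖𝔉(H)`: its underlying set is the set `SF(H)` of selfadjoint Fredholm operators. -/
def FredholmSpace (φ : ℝ → ℝ) (H : Type*) [NormedAddCommGroup H] [InnerProductSpace ℂ H]
    [CompleteSpace H] : Type _ :=
  {D : SelfAdjointOp H // D.IsFredholm}

/-- The inclusion of `𝔖𝔉_n(H)` into `𝔖𝔉(H)`. -/
def FredholmLevel.incl (φ : ℝ → ℝ) (n : ℕ+) (D : FredholmLevel φ n H) : FredholmSpace φ H :=
  ⟨D.1, D.2.1⟩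

/-- The inductive limit topology on `𝔖𝔉(H)`: a set is open if and only if its intersection with
each `𝔖𝔉_n(H)` is open there. -/
instance (φ : ℝ → ℝ) : TopologicalSpace (FredholmSpace φ H) :=
  ⨆ n : ℕ+, TopologicalSpace.coinduced (FredholmLevel.incl φ n) inferInstance

/-- On the set `I` the path `D` is a continuous path in `𝔖𝔉_n(H)`. -/
def ContinuousInLevel {φ : ℝ → ℝ} (n : ℕ+) (D : ℝ → FredholmSpace φ H) (I : Set ℝ) : Prop :=
  ∃ E : I → FredholmLevel φ n H, Continuous E ∧ ∀ t : I, FredholmLevel.incl φ n (E t) = D t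

/-- The situation in which the spectral flow of `D` over `[u, v]` is read off directly at the
level `μ > 0`: for some `n` with `μ < 1 / n` the path is continuous in `𝔖𝔉_n(H)`, and for all
`t ∈ [u, v]` both `μ` and `-μ` are in the resolvent set of `D_t` and `1_[-μ, μ](D_t)` has finite
rank. -/
def IsAdmissible {φ : ℝ → ℝ} (D : ℝ → FredholmSpace φ H) (u v μ : ℝ) : Prop :=
  0 < μ ∧ (∃ n : ℕ+, μ < 1 / (n : ℝ) ∧ ContinuousInLevel n D (Icc u v)) ∧
    ∀ t ∈ Icc u v, (D t).1.InResolventSet (μ : ℂ) ∧ (D t).1.InResolventSet (-(μ : ℂ)) ∧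
      FiniteDimensional ℂ ((D t).1.spectralSubspace (-μ) μ)

/-- The contribution `dim Ran 1_[0, μ](D_v) - dim Ran 1_[0, μ](D_u)` of the interval `[u, v]`. -/
def contribution {φ : ℝ → ℝ} (D : ℝ → FredholmSpace φ H) (u v μ : ℝ) : ℤ :=
  (Module.finrank ℂ ((D v).1.spectralSubspace 0 μ) : ℤ) -
    (Module.finrank ℂ ((D u).1.spectralSubspace 0 μ) : ℤ)

/-- `N` is a value of the spectral flow of `D` over `[a, b]`: it is the sum of the contributions of
the intervals of some subdivision `a = τ₀ ≤ τ₁ ≤ ⋯ ≤ τ_k = b` on each of which the spectral flow can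
be read off directly. -/
def IsSpectralFlow {φ : ℝ → ℝ} (D : ℝ → FredholmSpace φ H) (a b : ℝ) (N : ℤ) : Prop :=
  ∃ (k : ℕ) (τ μ : ℕ → ℝ), τ 0 = a ∧ τ k = b ∧
    (∀ i < k, τ i ≤ τ (i + 1) ∧ IsAdmissible D (τ i) (τ (i + 1)) (μ i)) ∧
    N = ∑ i ∈ Finset.range k, contribution D (τ i) (τ (i + 1)) (μ i)

open Classical in
/-- The spectral flow of the path `D` over `[a, b]`: the value obtained from any subdivision as in
`IsSpectralFlow` (and `0` if there is none). -/
def spfl {φ : ℝ → ℝ} (D : ℝ → FredholmSpace φ H) (a b : ℝ) : ℤ :=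
  if h : ∃ N : ℤ, IsSpectralFlow D a b N then h.choose else 0

end SpectralFlow

end

open Set Topology
open scoped ContDiff

noncomputable section

open Filter ComplexConjugate

namespace SpectralFlow

variable {H : Type*} [NormedAddCommGroup H] [InnerProductSpace ℂ H] [CompleteSpace H]

namespace SelfAdjointOp

/-! ### Resolvents of selfadjoint operators -/

/-! An operator `D` is handled through `R = (D + i)⁻¹`, a normal operator with spectrum on a circle,
so that `f(D)` for `f` vanishing at infinity is a continuous function of `R`. Spectral projections
are never formed: at a gap of the spectrum they coincide with `f(D)` for a trapezoidal `f`.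

Within one level the argument is classical. Strong resolvent continuity makes `f(D_t)` strongly
continuous (`tendsto_funcCalc`). If `f` is supported strictly inside the support of `φ_n`, then `f =
k φ_n`, and compactness of `φ_n(D_t)` upgrades this to norm continuity
(`continuous_funcCalc_of_cutoffOp`). Hence the rank of `1_[α, β](D_t)` is constant as long as `α`
and `β` stay in the resolvent set (`finrank_eq_of_preconnected`). Replacing `μ` by `μ'` changes the
dimensions at both ends by the same rank of `1_[μ, μ'](D_t)`, so the contribution of an interval
does not depend on `μ` (`contribution_eq`).

The heart is `exists_local_level`: a continuous family in the inductive limit lies locally in one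
level, continuously, with a common admissible `μ`. If the dimension near `0` jumped up along `x_k →
x₀` at ever smaller scales, the set of all `P x_k` would be closed in every level, hence closed,
although `P x_k → P x₀` (`exists_eventually_finrank_le`). Once the dimension is bounded above,
strong continuity bounds it below; the rank is then constant, a gap opens, and strongly continuous
projections of constant finite rank are norm continuous (`continuous_of_finrank_eq`).

Part (a) follows by compactness of `[a, b]`, the contributions being differences of one function
(`IsPotential`). For (b), on a small rectangle one `μ` serves all four sides and the corner
dimensions cancel; boundary sums add up under subdivision. In (c) the flows along the two remaining
sides vanish or agree. -/

theorem inner_op_left (D : SelfAdjointOp H) (x y : D.op.domain) :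
    inner ℂ (D.op x) (y : H) = inner ℂ (x : H) (D.op y) := by
  have h := LinearPMap.adjoint_isFormalAdjoint D.selfAdjoint.dense_domain
  rw [LinearPMap.isSelfAdjoint_def.1 D.selfAdjoint] at h
  exact h x y

/-- The hypothesis puts `y` in the domain of the adjoint, which is `D` itself. Whatever needs more
than symmetry and density of the domain goes through this weak test. -/
theorem exists_mem_domain (D : SelfAdjointOp H) {y w : H}
    (h : ∀ x : D.op.domain, inner ℂ w (x : H) = inner ℂ y (D.op x)) :
    ∃ hy : y ∈ D.op.domain, D.op ⟨y, hy⟩ = w := by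
  have h1 := LinearPMap.mem_adjoint_domain_of_exists y ⟨w, h⟩
  have h2 := LinearPMap.adjoint_apply_eq D.selfAdjoint.dense_domain ⟨y, h1⟩ h
  have h3 : LinearPMap.adjoint D.op = D.op := LinearPMap.isSelfAdjoint_def.1 D.selfAdjoint
  have h4 : y ∈ D.op.domain := by rwa [h3] at h1
  refine ⟨h4, ?_⟩
  rw [← h2]
  exact ((LinearPMap.ext_iff.1 h3).2 (hf := h1) (hg := h4)).symm

theorem im_inner_op_self (D : SelfAdjointOp H) (x : D.op.domain) :
    (inner ℂ (x : H) (D.op x)).im = 0 := by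
  have h := D.inner_op_left x x
  rw [← inner_conj_symm] at h
  exact Complex.conj_eq_iff_im.1 h

/-- Since `⟨x, D x⟩` is real, the imaginary part of `⟨x, (D - z) x⟩` is `-Im z ‖x‖²`; conclude by
Cauchy–Schwarz. -/
theorem norm_le_of_im (D : SelfAdjointOp H) (z : ℂ) (x : D.op.domain) :
    |z.im| * ‖(x : H)‖ ≤ ‖D.op x - z • (x : H)‖ := by
  have h1 : (inner ℂ (x : H) (D.op x - z • (x : H))).im = -(z.im * ‖(x : H)‖ ^ 2) := by
    rw [inner_sub_right, inner_smul_right, inner_self_eq_norm_sq_to_K, Complex.sub_im,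
      im_inner_op_self, zero_sub]
    congr 1
    change (z * (‖(x : H)‖ : ℂ) ^ 2).im = _
    rw [← Complex.ofReal_pow, Complex.im_mul_ofReal]
  have h2 : |z.im| * ‖(x : H)‖ ^ 2 ≤ ‖(x : H)‖ * ‖D.op x - z • (x : H)‖ := by
    calc |z.im| * ‖(x : H)‖ ^ 2 = |(inner ℂ (x : H) (D.op x - z • (x : H))).im| := by
          rw [h1, abs_neg, abs_mul, abs_of_nonneg (sq_nonneg ‖(x : H)‖)]
      _ ≤ ‖inner ℂ (x : H) (D.op x - z • (x : H))‖ := Complex.abs_im_le_norm _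
      _ ≤ _ := norm_inner_le_norm _ _
  rcases (norm_nonneg (x : H)).eq_or_lt with h | h
  · rw [← h, mul_zero]; exact norm_nonneg _
  · nlinarith

/-- The linear map `D - z : dom D → H`. -/
def subSMul (D : SelfAdjointOp H) (z : ℂ) : D.op.domain →ₗ[ℂ] H :=
  D.op.toFun - z • D.op.domain.subtype

theorem subSMul_apply (D : SelfAdjointOp H) (z : ℂ) (x : D.op.domain) :
    D.subSMul z x = D.op x - z • (x : H) := rfl

theorem isClosed_range_subSMul (D : SelfAdjointOp H) {z : ℂ} (hz : z.im ≠ 0) :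
    IsClosed (LinearMap.range (D.subSMul z) : Set H) := by
  have hz' : 0 < |z.im| := abs_pos.2 hz
  refine isClosed_of_closure_subset fun y hy => ?_
  obtain ⟨s, hs, hlim⟩ := mem_closure_iff_seq_limit.1 hy
  choose x hx using hs
  have hc : CauchySeq fun n => (x n : H) := by
    have h1 := hlim.cauchySeq
    rw [Metric.cauchySeq_iff'] at h1 ⊢
    intro ε hε
    obtain ⟨N, hN⟩ := h1 (|z.im| * ε) (by positivity)
    refine ⟨N, fun n hn => ?_⟩
    have h2 := hN n hn
    rw [dist_eq_norm, ← hx, ← hx, ← map_sub, subSMul_apply] at h2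
    have h3 := (D.norm_le_of_im z (x n - x N)).trans_lt h2
    rw [dist_eq_norm]
    exact lt_of_mul_lt_mul_left h3 hz'.le
  obtain ⟨x0, hx0⟩ := cauchySeq_tendsto_of_complete hc
  have hD : Tendsto (fun n => D.op (x n)) atTop (𝓝 (y + z • x0)) := by
    have h1 := hlim.add (hx0.const_smul z)
    refine h1.congr fun n => ?_
    rw [← hx, subSMul_apply]; abel
  obtain ⟨h0, h1⟩ := D.exists_mem_domain (y := x0) (w := y + z • x0) fun w => by
    have h1 : Tendsto (fun n => inner ℂ (D.op (x n)) (w : H)) atTop (𝓝 (inner ℂ (y + z • x0) (w : H))) :=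
      hD.inner tendsto_const_nhds
    have h2 : Tendsto (fun n => inner ℂ (x n : H) (D.op w)) atTop (𝓝 (inner ℂ x0 (D.op w))) :=
      hx0.inner tendsto_const_nhds
    exact tendsto_nhds_unique h1 (h2.congr fun n => (D.inner_op_left (x n) w).symm)
  refine ⟨⟨x0, h0⟩, ?_⟩
  rw [subSMul_apply, h1]; simp

/-- The range is closed, and a vector orthogonal to it would be an eigenvector for `conj z`, which
`norm_le_of_im` excludes. -/
theorem range_subSMul (D : SelfAdjointOp H) {z : ℂ} (hz : z.im ≠ 0) :
    LinearMap.range (D.subSMul z) = ⊤ := by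
  have : CompleteSpace (LinearMap.range (D.subSMul z)) :=
    (D.isClosed_range_subSMul hz).completeSpace_coe
  rw [← Submodule.orthogonal_eq_bot_iff, Submodule.eq_bot_iff]
  intro y hy
  have hy' : ∀ x : D.op.domain, inner ℂ y (D.op x - z • (x : H)) = 0 := fun x =>
    (Submodule.mem_orthogonal' _ y).1 hy _ ⟨x, rfl⟩
  obtain ⟨h0, h1⟩ := D.exists_mem_domain (y := y) (w := conj z • y) fun x => by
    have := hy' x
    rw [inner_sub_right, sub_eq_zero, inner_smul_right] at this
    rw [this, inner_smul_left, Complex.conj_conj]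
  have h2 := D.norm_le_of_im (conj z) ⟨y, h0⟩
  rw [h1, sub_self, norm_zero, Complex.conj_im, abs_neg] at h2
  have h3 : 0 < |z.im| := abs_pos.2 hz
  have h4 : ‖y‖ ≤ 0 := by
    by_contra h
    push Not at h
    exact absurd h2 (not_le.2 (mul_pos h3 h))
  exact norm_le_zero_iff.1 h4

theorem ker_subSMul (D : SelfAdjointOp H) {z : ℂ} (hz : z.im ≠ 0) :
    LinearMap.ker (D.subSMul z) = ⊥ := by
  rw [LinearMap.ker_eq_bot']
  intro x hx
  have h2 := D.norm_le_of_im z x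
  rw [← subSMul_apply, hx, norm_zero] at h2
  have h3 : 0 < |z.im| := abs_pos.2 hz
  have h4 : ‖(x : H)‖ ≤ 0 := by
    by_contra h
    push Not at h
    exact absurd h2 (not_le.2 (mul_pos h3 h))
  exact Subtype.ext (norm_le_zero_iff.1 h4)

theorem inResolventSet_of_im (D : SelfAdjointOp H) {z : ℂ} (hz : z.im ≠ 0) :
    D.InResolventSet z := by
  have h3 : 0 < |z.im| := abs_pos.2 hz
  let e : D.op.domain ≃ₗ[ℂ] H := LinearEquiv.ofBijective (D.subSMul z)
    ⟨LinearMap.ker_eq_bot.1 (D.ker_subSMul hz), LinearMap.range_eq_top.1 (D.range_subSMul hz)⟩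
  have he : ∀ x, D.op (e.symm x) - z • (e.symm x : H) = x := fun x => e.apply_symm_apply x
  let R : H →L[ℂ] H := (D.op.domain.subtype ∘ₗ (e.symm : H →ₗ[ℂ] D.op.domain)).mkContinuous
    (|z.im|⁻¹) fun x => by
      have h := D.norm_le_of_im z (e.symm x)
      rw [he] at h
      rw [inv_mul_eq_div, le_div_iff₀ h3, mul_comm]
      exact h
  refine ⟨R, fun x => ⟨(e.symm x).2, he x⟩, fun y => ?_⟩
  exact congrArg Subtype.val (e.symm_apply_apply y)

theorem isResolvent_resolvent (D : SelfAdjointOp H) {z : ℂ} (hz : D.InResolventSet z) :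
    D.IsResolvent z (D.resolvent z) := by
  rw [resolvent, dif_pos hz]
  exact hz.choose_spec

theorem isResolvent_neg_I (D : SelfAdjointOp H) :
    D.IsResolvent (-Complex.I) (D.resolvent (-Complex.I)) :=
  D.isResolvent_resolvent (D.inResolventSet_of_im (by simp))

theorem isResolvent_I (D : SelfAdjointOp H) :
    D.IsResolvent Complex.I (D.resolvent Complex.I) :=
  D.isResolvent_resolvent (D.inResolventSet_of_im (by simp))

/-- The resolvent identity. -/
theorem IsResolvent.sub_eq {D : SelfAdjointOp H} {z w : ℂ} {R S : H →L[ℂ] H}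
    (hR : D.IsResolvent z R) (hS : D.IsResolvent w S) : R - S = (z - w) • (R * S) := by
  ext x
  obtain ⟨h, hx⟩ := hS.1 x
  have h1 := hR.2 ⟨S x, h⟩
  have h2 : D.op ⟨S x, h⟩ = x + w • S x := sub_eq_iff_eq_add.1 hx
  rw [h2, map_sub, map_add, map_smul, map_smul] at h1
  change R x - S x = (z - w) • R (S x)
  change R x + w • R (S x) - z • R (S x) = S x at h1
  rw [sub_smul]
  nth_rw 1 [← h1]
  abel

theorem IsResolvent.star_eq {D : SelfAdjointOp H} {z : ℂ} {R S : H →L[ℂ] H}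
    (hR : D.IsResolvent z R) (hS : D.IsResolvent (conj z) S) : star R = S := by
  rw [ContinuousLinearMap.star_eq_adjoint, eq_comm, ContinuousLinearMap.eq_adjoint_iff]
  intro x y
  obtain ⟨h, hx⟩ := hS.1 x
  obtain ⟨h', hy⟩ := hR.1 y
  nth_rw 1 [← hy]
  nth_rw 2 [← hx]
  rw [inner_sub_left, inner_sub_right, inner_smul_left, inner_smul_right, Complex.conj_conj]
  congr 1
  exact (D.inner_op_left ⟨S x, h⟩ ⟨R y, h'⟩).symm

theorem star_resolvent (D : SelfAdjointOp H) :
    star (D.resolvent (-Complex.I)) = D.resolvent Complex.I :=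
  D.isResolvent_neg_I.star_eq (by simpa using D.isResolvent_I)

/-- The operator form of the equation of `resolventCircle`; it locates the spectrum. -/
theorem resolvent_sub_star (D : SelfAdjointOp H) :
    D.resolvent (-Complex.I) - star (D.resolvent (-Complex.I)) =
      (-2 * Complex.I) • (D.resolvent (-Complex.I) * star (D.resolvent (-Complex.I))) := by
  rw [star_resolvent, D.isResolvent_neg_I.sub_eq D.isResolvent_I]
  congr 1; ring

/-- The resolvent identity written for `(-i, i)` and for `(i, -i)` gives the product of the two
resolvents in both orders. -/
theorem isStarNormal_resolvent (D : SelfAdjointOp H) :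
    IsStarNormal (D.resolvent (-Complex.I)) := by
  refine ⟨?_⟩
  rw [star_resolvent]
  have h1 := D.isResolvent_neg_I.sub_eq D.isResolvent_I
  have h2 := D.isResolvent_I.sub_eq D.isResolvent_neg_I
  rw [← neg_sub, h1, ← neg_smul] at h2
  have h3 : -(-Complex.I - Complex.I) = Complex.I - -Complex.I := by ring
  rw [h3] at h2
  exact (smul_right_injective _ (by
    rw [sub_neg_eq_add]; intro h; simpa using congrArg Complex.im h) h2).symm

/-- `(D + i)⁻¹` determines `D`. -/
theorem ext_resolvent {D E : SelfAdjointOp H}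
    (h : D.resolvent (-Complex.I) = E.resolvent (-Complex.I)) : D = E := by
  have key : ∀ {D E : SelfAdjointOp H}, D.resolvent (-Complex.I) = E.resolvent (-Complex.I) →
      D.op ≤ E.op := by
    intro D E h
    have h1 : ∀ x : D.op.domain, ∃ hx : (x : H) ∈ E.op.domain, E.op ⟨x, hx⟩ = D.op x := by
      intro x
      have hx := D.isResolvent_neg_I.2 x
      have hy := E.isResolvent_neg_I.1 (D.op x - -Complex.I • (x : H))
      rw [h] at hx
      rw [hx] at hy
      obtain ⟨hy, hy'⟩ := hy
      exact ⟨hy, by simpa using hy'⟩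
    refine ⟨fun x hx => (h1 ⟨x, hx⟩).1, fun x y hxy => ?_⟩
    obtain ⟨hx, h2⟩ := h1 x
    rw [← h2]
    congr 1
    exact Subtype.ext hxy
  have h1 := le_antisymm (key h) (key h.symm)
  cases D; cases E; simp_all

end SelfAdjointOp

/-! ### Functions vanishing at infinity -/

/-- A continuous real function on the line that vanishes at infinity. -/
structure IsC0 (f : ℝ → ℝ) : Prop where
  cont : Continuous f
  zero_at_infty : Tendsto f (cocompact ℝ) (𝓝 0)

namespace IsC0

variable {f g : ℝ → ℝ}

theorem of_hasCompactSupport (hf : Continuous f) (h : HasCompactSupport f) : IsC0 f :=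
  ⟨hf, h.is_zero_at_infty⟩

theorem of_eq_zero (hf : Continuous f) {a b : ℝ} (h : ∀ t, t ∉ Icc a b → f t = 0) : IsC0 f :=
  of_hasCompactSupport hf (HasCompactSupport.intro isCompact_Icc h)

theorem mul (hf : IsC0 f) (hg : IsC0 g) : IsC0 fun t => f t * g t :=
  ⟨hf.cont.mul hg.cont, by simpa using hf.zero_at_infty.mul hg.zero_at_infty⟩

theorem add (hf : IsC0 f) (hg : IsC0 g) : IsC0 fun t => f t + g t :=
  ⟨hf.cont.add hg.cont, by simpa using hf.zero_at_infty.add hg.zero_at_infty⟩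

theorem sub (hf : IsC0 f) (hg : IsC0 g) : IsC0 fun t => f t - g t :=
  ⟨hf.cont.sub hg.cont, by simpa using hf.zero_at_infty.sub hg.zero_at_infty⟩

theorem const_mul (c : ℝ) (hf : IsC0 f) : IsC0 fun t => c * f t :=
  ⟨continuous_const.mul hf.cont, by simpa using hf.zero_at_infty.const_mul c⟩

theorem exists_bound (hf : IsC0 f) : ∃ C, 0 ≤ C ∧ ∀ t, |f t| ≤ C := by
  let F : ZeroAtInftyContinuousMap ℝ ℝ := ⟨⟨f, hf.cont⟩, hf.zero_at_infty⟩
  obtain ⟨C, hC⟩ := F.isBounded_range.exists_norm_le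
  exact ⟨C, (abs_nonneg _).trans (hC _ ⟨0, rfl⟩), fun t => hC _ ⟨t, rfl⟩⟩

end IsC0

theorem isC0_of_le_inv {f : ℝ → ℝ} (hf : Continuous f) (μ : ℝ)
    (h : ∀ t, |f t| * |t - μ| ≤ 1) : IsC0 f := by
  refine ⟨hf, ?_⟩
  have h1 : Tendsto (fun t : ℝ => ‖t‖ - |μ|) (cocompact ℝ) atTop :=
    tendsto_atTop_add_const_right _ _ (tendsto_norm_cocompact_atTop)
  refine squeeze_zero_norm' ?_ h1.inv_tendsto_atTop
  filter_upwards [h1.eventually_gt_atTop 0] with t ht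
  have h2 : ‖t‖ - |μ| ≤ |t - μ| := norm_sub_norm_le t μ
  change |f t| ≤ (‖t‖ - |μ|)⁻¹
  rw [← one_div, le_div_iff₀ ht]
  exact (mul_le_mul_of_nonneg_left h2 (abs_nonneg _)).trans (h t)

/-! ### The circle that carries the spectrum of the resolvents -/

/-- The circle that consists of `0` and of the points `1 / (x + i)`, `x` real. -/
def resolventCircle : Set ℂ := {z | z - conj z + 2 * Complex.I * (z * conj z) = 0}

theorem inv_im_of_mem_resolventCircle {z : ℂ} (hz : z ∈ resolventCircle) (h0 : z ≠ 0) :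
    z⁻¹.im = 1 := by
  have h1 : conj z ≠ 0 := by simpa using h0
  have h2 : (starRingEnd ℂ) z⁻¹ - z⁻¹ + 2 * Complex.I = 0 := by
    have h3 : z - conj z + 2 * Complex.I * (z * conj z) = 0 := hz
    rw [map_inv₀]
    field_simp
    linear_combination h3
  have h3 := congrArg Complex.im h2
  simp only [Complex.add_im, Complex.sub_im, Complex.conj_im] at h3
  simp at h3
  simp
  linarith

theorem inv_eq_of_mem_resolventCircle {z : ℂ} (hz : z ∈ resolventCircle) (h0 : z ≠ 0) :
    z⁻¹ = (z⁻¹.re : ℂ) + Complex.I := by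
  apply Complex.ext <;> simp [-Complex.inv_re, -Complex.inv_im, inv_im_of_mem_resolventCircle hz h0]

theorem isCompact_resolventCircle : IsCompact resolventCircle := by
  refine Metric.isCompact_of_isClosed_isBounded ?_ ?_
  · exact isClosed_eq (by fun_prop) continuous_const
  · refine (Metric.isBounded_closedBall (x := (0 : ℂ)) (r := 1)).subset fun z hz => ?_
    rw [mem_closedBall_zero_iff]
    by_cases h0 : z = 0
    · simp [h0]
    · have h1 := inv_im_of_mem_resolventCircle hz h0
      have h2 := Complex.abs_im_le_norm z⁻¹
      rw [h1, abs_one, norm_inv] at h2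
      exact (one_le_inv₀ (norm_pos_iff.2 h0)).1 h2

/-- The function on the circle that corresponds to the function `f` on the line. -/
def toCircle (f : ℝ → ℝ) (z : ℂ) : ℂ := if z = 0 then 0 else ((f (z⁻¹).re : ℝ) : ℂ)

/-- Only `z = 0` matters. On the circle `Im z⁻¹ = 1`, so `|Re z⁻¹| → ∞` as `z → 0`, and `f` vanishes
at infinity. -/
theorem continuousOn_toCircle {f : ℝ → ℝ} (hf : IsC0 f) :
    ContinuousOn (toCircle f) resolventCircle := by
  intro z hz
  by_cases h0 : z = 0
  · subst h0
    have h1 : Tendsto (fun z : ℂ => (z⁻¹).re) (𝓝[resolventCircle \ {0}] 0) (cocompact ℝ) := by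
      rw [← Metric.cobounded_eq_cocompact, ← tendsto_norm_atTop_iff_cobounded]
      have h2 : Tendsto (fun z : ℂ => ‖z⁻¹‖ - 1) (𝓝[resolventCircle \ {0}] 0) atTop := by
        refine tendsto_atTop_add_const_right _ _ ?_
        exact (tendsto_norm_cobounded_atTop.comp tendsto_inv₀_nhdsNE_zero).mono_left
          (nhdsWithin_mono _ (fun z hz => hz.2))
      refine tendsto_atTop_mono' _ ?_ h2
      filter_upwards [self_mem_nhdsWithin] with z hz
      have h3 := Complex.norm_le_abs_re_add_abs_im z⁻¹
      rw [inv_im_of_mem_resolventCircle hz.1 hz.2, abs_one] at h3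
      rw [Real.norm_eq_abs]
      linarith
    have h2 : ContinuousWithinAt (toCircle f) (resolventCircle \ {0}) 0 := by
      have h3 : Tendsto (fun z : ℂ => ((f (z⁻¹).re : ℝ) : ℂ)) (𝓝[resolventCircle \ {0}] 0)
          (𝓝 ((0 : ℝ) : ℂ)) := (Complex.continuous_ofReal.tendsto 0).comp (hf.zero_at_infty.comp h1)
      have h4 : toCircle f 0 = ((0 : ℝ) : ℂ) := by simp [toCircle]
      unfold ContinuousWithinAt
      rw [h4]
      refine h3.congr' ?_
      filter_upwards [self_mem_nhdsWithin] with z hz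
      have : z ≠ 0 := hz.2
      simp [toCircle, this]
    exact (continuousWithinAt_sdiff_self).1 h2
  · have h1 : ContinuousAt (fun z : ℂ => ((f (z⁻¹).re : ℝ) : ℂ)) z := by
      refine Complex.continuous_ofReal.continuousAt.comp (hf.cont.continuousAt.comp ?_)
      exact Complex.continuous_re.continuousAt.comp (continuousAt_inv₀ h0)
    refine (h1.congr ?_).continuousWithinAt
    filter_upwards [isOpen_ne.mem_nhds h0] with w hw
    have : w ≠ 0 := hw
    simp [toCircle, this]

/-! ### The functional calculus of a selfadjoint operator -/

namespace SelfAdjointOp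

theorem funcCalc_eq (D : SelfAdjointOp H) (f : ℝ → ℝ) :
    D.funcCalc f = cfc (toCircle f) (D.resolvent (-Complex.I)) := rfl

/-- By `resolvent_sub_star` the defining function of the circle is sent to `0` by the functional
calculus, so it vanishes on the spectrum. -/
theorem spectrum_resolvent_subset (D : SelfAdjointOp H) :
    spectrum ℂ (D.resolvent (-Complex.I)) ⊆ resolventCircle := by
  have hn := D.isStarNormal_resolvent
  have h : cfc (fun z : ℂ => z - star z + 2 * Complex.I * (z * star z)) (D.resolvent (-Complex.I))
      = cfc (fun _ => (0 : ℂ)) (D.resolvent (-Complex.I)) := by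
    rw [cfc_const_zero, cfc_add _ (fun z => z - star z) (fun z => 2 * Complex.I * (z * star z)),
      cfc_sub (fun z => z) (fun z => star z),
      cfc_const_mul (2 * Complex.I) (fun z => z * star z), cfc_mul (fun z => z) (fun z => star z),
      cfc_id' ℂ (D.resolvent (-Complex.I)) hn, cfc_star_id (a := D.resolvent (-Complex.I)) (ha := hn), resolvent_sub_star, ← add_smul]
    simp
  exact eqOn_of_cfc_eq_cfc h

theorem continuousOn_spectrum (D : SelfAdjointOp H) {f : ℝ → ℝ} (hf : IsC0 f) :
    ContinuousOn (toCircle f) (spectrum ℂ (D.resolvent (-Complex.I))) :=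
  (continuousOn_toCircle hf).mono D.spectrum_resolvent_subset

theorem funcCalc_mul (D : SelfAdjointOp H) {f g : ℝ → ℝ} (hf : IsC0 f) (hg : IsC0 g) :
    D.funcCalc (fun t => f t * g t) = D.funcCalc f * D.funcCalc g := by
  rw [funcCalc_eq, funcCalc_eq, funcCalc_eq,
    ← cfc_mul _ _ _ (D.continuousOn_spectrum hf) (D.continuousOn_spectrum hg)]
  congr 1; ext z; by_cases h : z = 0 <;> simp [toCircle, h]

theorem funcCalc_add (D : SelfAdjointOp H) {f g : ℝ → ℝ} (hf : IsC0 f) (hg : IsC0 g) :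
    D.funcCalc (fun t => f t + g t) = D.funcCalc f + D.funcCalc g := by
  rw [funcCalc_eq, funcCalc_eq, funcCalc_eq,
    ← cfc_add _ _ _ (D.continuousOn_spectrum hf) (D.continuousOn_spectrum hg)]
  congr 1; ext z; by_cases h : z = 0 <;> simp [toCircle, h]

theorem funcCalc_sub (D : SelfAdjointOp H) {f g : ℝ → ℝ} (hf : IsC0 f) (hg : IsC0 g) :
    D.funcCalc (fun t => f t - g t) = D.funcCalc f - D.funcCalc g := by
  rw [funcCalc_eq, funcCalc_eq, funcCalc_eq,
    ← cfc_sub _ _ _ (D.continuousOn_spectrum hf) (D.continuousOn_spectrum hg)]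
  congr 1; ext z; by_cases h : z = 0 <;> simp [toCircle, h]

theorem funcCalc_const_mul (D : SelfAdjointOp H) {f : ℝ → ℝ} (c : ℝ) (hf : IsC0 f) :
    D.funcCalc (fun t => c * f t) = (c : ℂ) • D.funcCalc f := by
  rw [funcCalc_eq, funcCalc_eq, ← cfc_const_mul _ _ _ (D.continuousOn_spectrum hf)]
  congr 1; ext z; by_cases h : z = 0 <;> simp [toCircle, h]

theorem star_funcCalc (D : SelfAdjointOp H) (f : ℝ → ℝ) :
    star (D.funcCalc f) = D.funcCalc f := by
  rw [funcCalc_eq, ← cfc_star]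
  congr 1; ext z; by_cases h : z = 0 <;> simp [toCircle, h]

theorem inner_funcCalc_left (D : SelfAdjointOp H) (f : ℝ → ℝ) (x y : H) :
    inner ℂ (D.funcCalc f x) y = inner ℂ x (D.funcCalc f y) := by
  nth_rw 1 [← D.star_funcCalc f]
  rw [ContinuousLinearMap.star_eq_adjoint, ContinuousLinearMap.adjoint_inner_left]

theorem norm_funcCalc_le (D : SelfAdjointOp H) {f : ℝ → ℝ} {c : ℝ} (hc : 0 ≤ c)
    (h : ∀ t, |f t| ≤ c) : ‖D.funcCalc f‖ ≤ c := by
  refine norm_cfc_le hc fun z _ => ?_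
  by_cases h0 : z = 0
  · simpa [h0] using hc
  · simpa [h0, -Complex.inv_re] using h _

/-- If `t * f t = c + g t` for all `t`, then `D f(D) = c + g(D)`. -/
theorem op_funcCalc (D : SelfAdjointOp H) {f g : ℝ → ℝ} (hf : IsC0 f) (hg : IsC0 g) (c : ℝ)
    (h : ∀ t, t * f t = c + g t) (x : H) :
    ∃ hx : D.funcCalc f x ∈ D.op.domain,
      D.op ⟨D.funcCalc f x, hx⟩ = (c : ℂ) • x + D.funcCalc g x := by
  have hn := D.isStarNormal_resolvent
  have hcf := D.continuousOn_spectrum hf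
  have hcg := D.continuousOn_spectrum hg
  -- At `z = 1 / (s + i)` the hypothesis reads `f = z (c + g + i f)`, and at `z = 0` both sides
  -- vanish. So `f(D)` factors through the resolvent, whose range is the domain.
  have key : D.funcCalc f = D.resolvent (-Complex.I) *
      ((c : ℂ) • (1 : H →L[ℂ] H) + D.funcCalc g + Complex.I • D.funcCalc f) := by
    have h1 : D.funcCalc f = cfc (fun z : ℂ => z * ((c : ℂ) + toCircle g z + Complex.I * toCircle f z))
        (D.resolvent (-Complex.I)) := by
      rw [funcCalc_eq]
      refine cfc_congr fun z hz => ?_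
      have hz' := D.spectrum_resolvent_subset hz
      by_cases h0 : z = 0
      · simp [h0, toCircle]
      · have h2 := inv_eq_of_mem_resolventCircle hz' h0
        have h3 := h (z⁻¹).re
        simp only [toCircle, h0, if_false]
        set s := (z⁻¹).re with hs
        have h4 : (s : ℂ) * (f s : ℂ) = c + g s := by exact_mod_cast h3
        rw [← h4, ← add_mul, ← h2, ← mul_assoc, mul_inv_cancel₀ h0, one_mul]
    refine h1.trans ?_
    rw [cfc_mul (fun z : ℂ => z) (fun z => (c : ℂ) + toCircle g z + Complex.I * toCircle f z) _
      continuousOn_id ((continuousOn_const.add hcg).add (continuousOn_const.mul hcf)),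
      cfc_add _ (fun z => (c : ℂ) + toCircle g z) (fun z => Complex.I * toCircle f z)
        (continuousOn_const.add hcg) (continuousOn_const.mul hcf),
      cfc_add _ (fun z => (c : ℂ)) (fun z => toCircle g z) continuousOn_const hcg,
      cfc_const_mul _ _ _ hcf, cfc_id' ℂ (D.resolvent (-Complex.I)) hn, cfc_const _ _ hn, funcCalc_eq, funcCalc_eq,
      Algebra.algebraMap_eq_smul_one]
  have h2 := D.isResolvent_neg_I.1
    ((((c : ℂ) • (1 : H →L[ℂ] H) + D.funcCalc g + Complex.I • D.funcCalc f)) x)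
  have h3 : D.resolvent (-Complex.I)
    ((((c : ℂ) • (1 : H →L[ℂ] H) + D.funcCalc g + Complex.I • D.funcCalc f)) x) = D.funcCalc f x := by
    conv_rhs => rw [key]
    rfl
  rw [h3] at h2
  obtain ⟨hx, h4⟩ := h2
  refine ⟨hx, ?_⟩
  rw [sub_eq_iff_eq_add] at h4
  rw [h4]
  simp

end SelfAdjointOp

/-! ### Strong continuity of the functional calculus -/

omit [CompleteSpace H] in
theorem tendsto_apply_of_bounded {ι : Type*} {l : Filter ι} {A : ι → H →L[ℂ] H} {A₀ : H →L[ℂ] H}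
    {C : ℝ} (hC : ∀ i, ‖A i‖ ≤ C) (hA : ∀ x, Tendsto (fun i => A i x) l (𝓝 (A₀ x)))
    {y : ι → H} {y₀ : H} (hy : Tendsto y l (𝓝 y₀)) :
    Tendsto (fun i => A i (y i)) l (𝓝 (A₀ y₀)) := by
  have h1 : Tendsto (fun i => A i (y i - y₀)) l (𝓝 0) := by
    have h2 : Tendsto (fun i => C * ‖y i - y₀‖) l (𝓝 0) := by
      have h3 := (tendsto_iff_norm_sub_tendsto_zero.1 hy).const_mul C
      rwa [mul_zero] at h3
    exact squeeze_zero_norm (fun i => (A i).le_of_opNorm_le (hC i) _) h2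
  have h2 := (hA y₀).add h1
  rw [add_zero] at h2
  refine h2.congr fun i => ?_
  rw [← map_add]; congr 1; abel

/-- Extension by zero of a function on the circle. -/
def circleExtend (F : C(resolventCircle, ℂ)) : ℂ → ℂ := Function.extend Subtype.val F 0

theorem circleExtend_apply (F : C(resolventCircle, ℂ)) (z : resolventCircle) :
    circleExtend F z = F z := Subtype.val_injective.extend_apply _ _ _

namespace SelfAdjointOp

/-- The functional calculus of `(D + i)⁻¹` for continuous functions on the circle. -/
def circleCalc (D : SelfAdjointOp H) (F : C(resolventCircle, ℂ)) : H →L[ℂ] H :=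
  cfc (circleExtend F) (D.resolvent (-Complex.I))

theorem continuousOn_circleExtend (D : SelfAdjointOp H) (F : C(resolventCircle, ℂ)) :
    ContinuousOn (circleExtend F) (spectrum ℂ (D.resolvent (-Complex.I))) := by
  refine ContinuousOn.mono ?_ D.spectrum_resolvent_subset
  rw [continuousOn_iff_continuous_domRestrict]
  refine F.continuous.congr fun z => ?_
  exact (circleExtend_apply F z).symm

theorem circleCalc_eq (D : SelfAdjointOp H) {F : C(resolventCircle, ℂ)} {f : ℂ → ℂ}
    (h : ∀ z : resolventCircle, F z = f z) :
    D.circleCalc F = cfc f (D.resolvent (-Complex.I)) :=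
  cfc_congr fun z hz => by
    have := circleExtend_apply F ⟨z, D.spectrum_resolvent_subset hz⟩
    rw [h] at this
    exact this

theorem circleCalc_add (D : SelfAdjointOp H) (F G : C(resolventCircle, ℂ)) :
    D.circleCalc (F + G) = D.circleCalc F + D.circleCalc G := by
  rw [circleCalc, circleCalc, circleCalc,
    ← cfc_add _ _ _ (D.continuousOn_circleExtend F) (D.continuousOn_circleExtend G)]
  exact D.circleCalc_eq fun z => by simp [circleExtend_apply]

theorem circleCalc_sub (D : SelfAdjointOp H) (F G : C(resolventCircle, ℂ)) :
    D.circleCalc (F - G) = D.circleCalc F - D.circleCalc G := by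
  rw [circleCalc, circleCalc, circleCalc,
    ← cfc_sub _ _ _ (D.continuousOn_circleExtend F) (D.continuousOn_circleExtend G)]
  exact D.circleCalc_eq fun z => by simp [circleExtend_apply]

theorem circleCalc_mul (D : SelfAdjointOp H) (F G : C(resolventCircle, ℂ)) :
    D.circleCalc (F * G) = D.circleCalc F * D.circleCalc G := by
  rw [circleCalc, circleCalc, circleCalc,
    ← cfc_mul _ _ _ (D.continuousOn_circleExtend F) (D.continuousOn_circleExtend G)]
  exact D.circleCalc_eq fun z => by simp [circleExtend_apply]

theorem norm_circleCalc_le (D : SelfAdjointOp H) (F : C(resolventCircle, ℂ))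
    [CompactSpace resolventCircle] : ‖D.circleCalc F‖ ≤ ‖F‖ :=
  norm_cfc_le (norm_nonneg _) fun z hz => by
    rw [circleExtend_apply F ⟨z, D.spectrum_resolvent_subset hz⟩]
    exact F.norm_coe_le_norm _

/-- Stone–Weierstrass: the functions with this property contain the constants, `z` and `conj z`, and
are stable under sums, products (by uniform boundedness) and uniform limits. Both resolvents are
needed because strong convergence does not pass to adjoints. -/
theorem tendsto_circleCalc {ι : Type*} {l : Filter ι} {D : ι → SelfAdjointOp H}
    {E : SelfAdjointOp H}
    (h1 : ∀ x, Tendsto (fun i => (D i).resolvent (-Complex.I) x) l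
      (𝓝 (E.resolvent (-Complex.I) x)))
    (h2 : ∀ x, Tendsto (fun i => (D i).resolvent Complex.I x) l (𝓝 (E.resolvent Complex.I x)))
    (F : C(resolventCircle, ℂ)) (x : H) :
    Tendsto (fun i => (D i).circleCalc F x) l (𝓝 (E.circleCalc F x)) := by
  have : CompactSpace resolventCircle := isCompact_iff_compactSpace.1 isCompact_resolventCircle
  induction F using ContinuousMap.induction_on_of_compact generalizing x with
  | const r =>
    have h : ∀ D : SelfAdjointOp H, D.circleCalc (.const _ r) x = r • x := fun D => by
      have hn := D.isStarNormal_resolvent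
      rw [D.circleCalc_eq (f := fun _ => r) fun z => rfl, cfc_const _ _ hn,
        Algebra.algebraMap_eq_smul_one]
      rfl
    simp only [h]
    exact tendsto_const_nhds
  | id =>
    have h : ∀ D : SelfAdjointOp H, D.circleCalc (.restrict _ (.id ℂ)) =
        D.resolvent (-Complex.I) := fun D => by
      have hn := D.isStarNormal_resolvent
      rw [D.circleCalc_eq (f := fun z => z) fun z => rfl, cfc_id' ℂ (D.resolvent (-Complex.I)) hn]
    simp only [h]
    exact h1 x
  | star_id =>
    have h : ∀ D : SelfAdjointOp H, D.circleCalc (star (.restrict _ (.id ℂ))) =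
        D.resolvent Complex.I := fun D => by
      have hn := D.isStarNormal_resolvent
      rw [D.circleCalc_eq (f := fun z => star z) fun z => rfl,
        cfc_star_id (a := D.resolvent (-Complex.I)) (ha := hn), star_resolvent]
    simp only [h]
    exact h2 x
  | add F G hF hG =>
    simp only [circleCalc_add]
    exact (hF x).add (hG x)
  | mul F G hF hG =>
    simp only [circleCalc_mul]
    exact tendsto_apply_of_bounded (fun i => (D i).norm_circleCalc_le F) hF (hG x)
  | frequently F hF =>
    rw [Metric.tendsto_nhds]
    intro ε hε
    obtain ⟨G, hG, hGF⟩ := (hF.and_eventually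
      (Metric.ball_mem_nhds F (show 0 < ε / (3 * (‖x‖ + 1)) by positivity))).exists
    have h3 : ∀ D : SelfAdjointOp H, ‖D.circleCalc F x - D.circleCalc G x‖ < ε / 3 := fun D => by
      rw [← sub_apply, ← circleCalc_sub]
      have h4 : ‖F - G‖ < ε / (3 * (‖x‖ + 1)) := by
        rw [← dist_eq_norm, dist_comm]; exact hGF
      calc ‖D.circleCalc (F - G) x‖ ≤ ‖F - G‖ * ‖x‖ :=
            (D.circleCalc (F - G)).le_of_opNorm_le (D.norm_circleCalc_le _) _
        _ ≤ ‖F - G‖ * (‖x‖ + 1) := by gcongr; linarith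
        _ < ε / (3 * (‖x‖ + 1)) * (‖x‖ + 1) := by gcongr
        _ = ε / 3 := by field_simp
    filter_upwards [Metric.tendsto_nhds.1 (hG x) (ε / 3) (by positivity)] with i hi
    have h5 := h3 (D i)
    have h6 := h3 E
    rw [dist_eq_norm] at hi ⊢
    rw [← norm_neg, neg_sub] at h6
    calc ‖(D i).circleCalc F x - E.circleCalc F x‖
        = ‖((D i).circleCalc F x - (D i).circleCalc G x)
          + ((D i).circleCalc G x - E.circleCalc G x)
          + (E.circleCalc G x - E.circleCalc F x)‖ := by congr 1; abel
      _ ≤ _ := norm_add₃_le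
      _ < ε := by linarith

theorem tendsto_funcCalc {ι : Type*} {l : Filter ι} {D : ι → SelfAdjointOp H}
    {E : SelfAdjointOp H}
    (h1 : ∀ x, Tendsto (fun i => (D i).resolvent (-Complex.I) x) l
      (𝓝 (E.resolvent (-Complex.I) x)))
    (h2 : ∀ x, Tendsto (fun i => (D i).resolvent Complex.I x) l (𝓝 (E.resolvent Complex.I x)))
    {f : ℝ → ℝ} (hf : IsC0 f) (x : H) :
    Tendsto (fun i => (D i).funcCalc f x) l (𝓝 (E.funcCalc f x)) := by
  let F : C(resolventCircle, ℂ) := ⟨_, (continuousOn_toCircle hf).domRestrict⟩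
  have h : ∀ D : SelfAdjointOp H, D.funcCalc f = D.circleCalc F := fun D =>
    (D.circleCalc_eq fun z => rfl).symm
  simp only [h]
  exact tendsto_circleCalc h1 h2 F x

end SelfAdjointOp

/-! ### Trapezoidal functions -/

/-- The piecewise linear function that is `1` on `[a, b]` and `0` outside `[a - δ, b + δ]`. -/
def trapezoid (a b δ t : ℝ) : ℝ := max 0 (1 - max 0 (max (a - t) (t - b)) / δ)

theorem continuous_trapezoid (a b δ : ℝ) : Continuous (trapezoid a b δ) := by
  unfold trapezoid; fun_prop

theorem trapezoid_nonneg (a b δ t : ℝ) : 0 ≤ trapezoid a b δ t := le_max_left _ _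

theorem trapezoid_le_one (a b t : ℝ) {δ : ℝ} (hδ : 0 < δ) : trapezoid a b δ t ≤ 1 :=
  max_le zero_le_one (sub_le_self _ (by positivity))

theorem trapezoid_eq_one {a b t : ℝ} (δ : ℝ) (ht : t ∈ Icc a b) : trapezoid a b δ t = 1 := by
  have h : max (a - t) (t - b) ≤ 0 := max_le (by linarith [ht.1]) (by linarith [ht.2])
  simp [trapezoid, max_eq_left h]

theorem trapezoid_eq_zero {a b δ t : ℝ} (hδ : 0 < δ) (ht : t ≤ a - δ ∨ b + δ ≤ t) :
    trapezoid a b δ t = 0 := by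
  have h : δ ≤ max 0 (max (a - t) (t - b)) := by
    rcases ht with h | h
    · exact le_max_of_le_right (le_max_of_le_left (by linarith))
    · exact le_max_of_le_right (le_max_of_le_right (by linarith))
  refine max_eq_left ?_
  rw [sub_nonpos, le_div_iff₀ hδ, one_mul]
  exact h

theorem trapezoid_eq_zero_of_notMem {a b δ t : ℝ} (hδ : 0 < δ) (ht : t ∉ Icc (a - δ) (b + δ)) :
    trapezoid a b δ t = 0 := by
  refine trapezoid_eq_zero hδ ?_
  by_contra h
  push Not at h
  exact ht ⟨h.1.le, h.2.le⟩

theorem isC0_trapezoid (a b : ℝ) {δ : ℝ} (hδ : 0 < δ) : IsC0 (trapezoid a b δ) :=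
  .of_eq_zero (continuous_trapezoid a b δ) fun _ => trapezoid_eq_zero_of_notMem hδ

theorem hasCompactSupport_trapezoid (a b : ℝ) {δ : ℝ} (hδ : 0 < δ) :
    HasCompactSupport (trapezoid a b δ) :=
  HasCompactSupport.intro isCompact_Icc fun _ => trapezoid_eq_zero_of_notMem hδ

namespace SelfAdjointOp

/-! ### Spectral subspaces -/

variable {D : SelfAdjointOp H} {α β : ℝ}

theorem spectralSubspace_mono {α' β' : ℝ} (h1 : α' ≤ α) (h2 : β ≤ β') :
    D.spectralSubspace α β ≤ D.spectralSubspace α' β' :=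
  fun _ hx f hf hs h => hx f hf hs fun t ht => h t ⟨h1.trans ht.1, ht.2.trans h2⟩

theorem funcCalc_congr_of_mem {x : H} (hx : x ∈ D.spectralSubspace α β) {f g : ℝ → ℝ}
    (hf : IsC0 f) (hg : IsC0 g) (h : ∀ t ∈ Icc α β, f t = g t) :
    D.funcCalc f x = D.funcCalc g x := by
  have he := isC0_trapezoid α β one_pos
  have h1 := hx _ (continuous_trapezoid α β 1) (hasCompactSupport_trapezoid α β one_pos)
    fun t ht => trapezoid_eq_one 1 ht
  -- With `e` the trapezoid, both `e` and `(f - g) e + e` equal `1` on `[α, β]`, so both fix `x`;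
  -- the difference gives `(f - g)(D) x = 0`.
  have h2 := hx (fun t => (f t - g t) * trapezoid α β 1 t + trapezoid α β 1 t)
    (((hf.cont.sub hg.cont).mul he.cont).add he.cont)
    (HasCompactSupport.intro (isCompact_Icc (a := α - 1) (b := β + 1)) fun t ht => by
      simp [trapezoid_eq_zero_of_notMem one_pos ht])
    fun t ht => by simp [h t ht, trapezoid_eq_one 1 ht]
  rw [D.funcCalc_add ((hf.sub hg).mul he) he, D.funcCalc_mul (hf.sub hg) he,
    D.funcCalc_sub hf hg, add_apply, h1, add_eq_right] at h2
  change D.funcCalc f (D.funcCalc _ x) - D.funcCalc g (D.funcCalc _ x) = 0 at h2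
  rw [h1] at h2
  exact sub_eq_zero.1 h2

theorem funcCalc_eq_self_of_mem {x : H} (hx : x ∈ D.spectralSubspace α β) {f : ℝ → ℝ}
    (hf : IsC0 f) (h : ∀ t ∈ Icc α β, f t = 1) : D.funcCalc f x = x := by
  rw [← hx _ (continuous_trapezoid α β 1) (hasCompactSupport_trapezoid α β one_pos)
    fun t ht => trapezoid_eq_one 1 ht]
  rw [← mul_apply_eq_comp, ← D.funcCalc_mul hf (isC0_trapezoid α β one_pos)]
  exact funcCalc_congr_of_mem hx (hf.mul (isC0_trapezoid α β one_pos))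
    (isC0_trapezoid α β one_pos) fun t ht => by rw [h t ht, one_mul]

theorem funcCalc_mem_spectralSubspace {f : ℝ → ℝ} (hf : IsC0 f)
    (h : ∀ t, t ∉ Icc α β → f t = 0) (x : H) : D.funcCalc f x ∈ D.spectralSubspace α β := by
  intro g hg hs h1
  rw [← mul_apply_eq_comp, ← D.funcCalc_mul (.of_hasCompactSupport hg hs) hf]
  congr 2
  ext t
  by_cases ht : t ∈ Icc α β
  · rw [h1 t ht, one_mul]
  · rw [h t ht, mul_zero]

theorem norm_funcCalc_apply_le {x : H} (hx : x ∈ D.spectralSubspace α β) {f : ℝ → ℝ}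
    (hf : IsC0 f) {c : ℝ} (hc : 0 ≤ c) (h : ∀ t ∈ Icc α β, |f t| ≤ c) :
    ‖D.funcCalc f x‖ ≤ c * ‖x‖ := by
  -- On `x` only the values of `f` on `[α, β]` matter, so `f` may be truncated to `[-c, c]`.
  have hg : IsC0 fun t => max (-c) (min c (f t)) := by
    refine ⟨by have := hf.cont; fun_prop, ?_⟩
    have h1 : Continuous fun s : ℝ => max (-c) (min c s) := by fun_prop
    have h2 := (h1.tendsto' 0 0 (by simp [hc])).comp hf.zero_at_infty
    exact h2
  rw [funcCalc_congr_of_mem hx hf hg fun t ht => by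
    have := abs_le.1 (h t ht)
    rw [min_eq_right this.2, max_eq_right this.1]]
  refine (D.funcCalc _).le_of_opNorm_le (D.norm_funcCalc_le hc fun t => abs_le.2 ⟨le_max_left _ _, ?_⟩) _
  exact max_le (by linarith) (min_le_left _ _)

/-- The operator `D` on a spectral subspace. -/
theorem norm_op_sub_le {x : H} (hx : x ∈ D.spectralSubspace α β) {μ c : ℝ} (hc : 0 ≤ c)
    (h : ∀ t ∈ Icc α β, |t - μ| ≤ c) :
    ∃ h' : x ∈ D.op.domain, ‖D.op ⟨x, h'⟩ - (μ : ℂ) • x‖ ≤ c * ‖x‖ := by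
  have he := isC0_trapezoid α β one_pos
  have hg : IsC0 fun t => t * trapezoid α β 1 t :=
    .of_eq_zero (continuous_id.mul he.cont) (a := α - 1) (b := β + 1) fun t ht => by
      rw [trapezoid_eq_zero_of_notMem one_pos ht, mul_zero]
  have h1 := D.op_funcCalc he hg 0 (fun t => (zero_add _).symm) x
  rw [funcCalc_eq_self_of_mem hx he fun t ht => trapezoid_eq_one 1 ht] at h1
  obtain ⟨h', h2⟩ := h1
  refine ⟨h', ?_⟩
  rw [h2, Complex.ofReal_zero, zero_smul, zero_add]
  have h3 : D.funcCalc (fun t => t * trapezoid α β 1 t) x - (μ : ℂ) • x =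
      D.funcCalc (fun t => t * trapezoid α β 1 t - μ * trapezoid α β 1 t) x := by
    rw [D.funcCalc_sub hg (he.const_mul μ), D.funcCalc_const_mul μ he, sub_apply, smul_apply,
      funcCalc_eq_self_of_mem hx he fun t ht => trapezoid_eq_one 1 ht]
  rw [h3]
  refine norm_funcCalc_apply_le hx (hg.sub (he.const_mul μ)) hc fun t ht => ?_
  rw [trapezoid_eq_one 1 ht, mul_one, mul_one]
  exact h t ht

/-! ### Spectral gaps -/

/-- On the spectral subspace `D - μ` has norm at most `η`, so a bounded inverse `S` gives `‖x‖ ≤ ‖S‖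
η ‖x‖`; take `η` with `‖S‖ η < 1`. -/
theorem exists_gap {μ : ℝ} (h : D.InResolventSet (μ : ℂ)) :
    ∃ η > 0, D.spectralSubspace (μ - η) (μ + η) = ⊥ := by
  obtain ⟨S, -, hS⟩ := h
  refine ⟨1 / (‖S‖ + 1), by positivity, ?_⟩
  rw [Submodule.eq_bot_iff]
  intro x hx
  obtain ⟨h', h1⟩ := norm_op_sub_le hx (μ := μ) (c := 1 / (‖S‖ + 1)) (by positivity)
    fun t ht => abs_le.2 ⟨by linarith [ht.1], by linarith [ht.2]⟩
  have h2 := S.le_of_opNorm_le le_rfl (D.op ⟨x, h'⟩ - (μ : ℂ) • x)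
  rw [hS ⟨x, h'⟩] at h2
  by_contra hx0
  have h3 : 0 < ‖x‖ := norm_pos_iff.2 hx0
  have h4 : ‖x‖ ≤ ‖S‖ * (1 / (‖S‖ + 1) * ‖x‖) :=
    h2.trans (mul_le_mul_of_nonneg_left h1 (norm_nonneg _))
  have h5 : ‖S‖ * (1 / (‖S‖ + 1) * ‖x‖) < ‖x‖ := by
    rw [← mul_assoc, mul_one_div]
    refine mul_lt_of_lt_one_left h3 ?_
    rw [div_lt_one (by positivity)]
    linarith
  linarith

theorem funcCalc_eq_zero (h : D.spectralSubspace α β = ⊥) {f : ℝ → ℝ} (hf : Continuous f)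
    (hf' : ∀ t, t ∉ Icc α β → f t = 0) : D.funcCalc f = 0 := by
  ext x
  have := funcCalc_mem_spectralSubspace (D := D) (.of_eq_zero hf hf') hf' x
  rw [h] at this
  exact this

/-- The inverse is `k(D)` for `k(t) = (t - μ) / max((t - μ)², η²)`, a continuous function equal to
`1 / (t - μ)` off the gap. The defect `1 - (t - μ) k(t)` lives in the gap and is killed by the
calculus. -/
theorem inResolventSet_of_gap {μ η : ℝ} (hη : 0 < η)
    (h : D.spectralSubspace (μ - η) (μ + η) = ⊥) : D.InResolventSet (μ : ℂ) := by
  set m : ℝ → ℝ := fun t => max ((t - μ) ^ 2) (η ^ 2) with hm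
  have hm0 : ∀ t, 0 < m t := fun t => lt_max_of_lt_right (by positivity)
  have hmc : Continuous m := by fun_prop
  have hk : IsC0 fun t => (t - μ) / m t := by
    refine isC0_of_le_inv ?_ μ fun t => ?_
    · exact (continuous_id.sub continuous_const).div hmc fun t => (hm0 t).ne'
    · rw [abs_div, abs_of_pos (hm0 t), div_mul_eq_mul_div, div_le_one (hm0 t), ← sq, sq_abs]
      exact le_max_left _ _
  have hf0 : ∀ t, t ∉ Icc (μ - η) (μ + η) → 1 - (t - μ) ^ 2 / m t = 0 := by
    intro t ht
    have h1 : η ^ 2 ≤ (t - μ) ^ 2 := by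
      rw [sq_le_sq, abs_of_pos hη]
      by_contra h2
      push Not at h2
      have := abs_lt.1 h2
      exact ht ⟨by linarith, by linarith⟩
    have h2 : m t = (t - μ) ^ 2 := max_eq_left h1
    rw [h2, div_self (by rw [← h2]; exact (hm0 t).ne'), sub_self]
  have hfc : Continuous fun t => 1 - (t - μ) ^ 2 / m t :=
    continuous_const.sub (((continuous_id.sub continuous_const).pow 2).div hmc
      fun t => (hm0 t).ne')
  have hf := IsC0.of_eq_zero hfc hf0
  have hD := funcCalc_eq_zero h hfc hf0
  have key := fun x => D.op_funcCalc hk ((hk.const_mul μ).sub hf) 1 (fun t => by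
    have := (hm0 t).ne'
    field_simp
    ring) x
  have key' : ∀ x, ∃ h : D.funcCalc (fun t => (t - μ) / m t) x ∈ D.op.domain,
      D.op ⟨_, h⟩ - (μ : ℂ) • D.funcCalc (fun t => (t - μ) / m t) x = x := fun x => by
    obtain ⟨h1, h2⟩ := key x
    refine ⟨h1, ?_⟩
    rw [h2, D.funcCalc_sub (hk.const_mul μ) hf, hD, D.funcCalc_const_mul μ hk]
    simp
  refine ⟨D.funcCalc fun t => (t - μ) / m t, key', fun y => ?_⟩
  -- As `k(D)` is selfadjoint and `D` symmetric, the left inverse property is dual to the right one.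
  refine ext_inner_left ℂ fun v => ?_
  rw [← inner_funcCalc_left]
  obtain ⟨h1, h2⟩ := key' v
  conv_rhs => rw [← h2]
  rw [inner_sub_left, inner_sub_right, inner_smul_left, inner_smul_right, Complex.conj_ofReal]
  congr 1
  exact (D.inner_op_left ⟨_, h1⟩ y).symm

theorem spectralSubspace_inf_eq_bot {γ δ : ℝ} (h : β < γ) :
    D.spectralSubspace α β ⊓ D.spectralSubspace γ δ = ⊥ := by
  rw [Submodule.eq_bot_iff]
  rintro x ⟨h1, h2⟩
  have hp : 0 < γ - β := sub_pos.2 h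
  rw [← funcCalc_eq_self_of_mem h2 (isC0_trapezoid γ δ hp) fun t ht => trapezoid_eq_one _ ht,
    funcCalc_congr_of_mem h1 (isC0_trapezoid γ δ hp) ((isC0_trapezoid γ δ hp).const_mul 0)
      fun t ht => by
        rw [zero_mul]; exact trapezoid_eq_zero hp (Or.inl (by linarith [ht.2])),
    D.funcCalc_const_mul 0 (isC0_trapezoid γ δ hp)]
  simp

/-- A point of the resolvent set splits a spectral subspace. -/
theorem finrank_spectralSubspace_add {μ : ℝ} (hα : α ≤ μ) (hβ : μ ≤ β)
    (hμ : D.InResolventSet (μ : ℂ)) [FiniteDimensional ℂ (D.spectralSubspace α β)] :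
    Module.finrank ℂ (D.spectralSubspace α β) =
      Module.finrank ℂ (D.spectralSubspace α μ) + Module.finrank ℂ (D.spectralSubspace μ β) := by
  obtain ⟨η, hη, hgap⟩ := exists_gap hμ
  have hη2 : 0 < η / 2 := by positivity
  have hinf : D.spectralSubspace α μ ⊓ D.spectralSubspace μ β = ⊥ := by
    rw [Submodule.eq_bot_iff]
    rintro x ⟨h1, h2⟩
    have e1 := isC0_trapezoid α μ hη
    have e2 := isC0_trapezoid μ β hη
    rw [← funcCalc_eq_self_of_mem h1 e1 fun t ht => trapezoid_eq_one _ ht]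
    nth_rw 1 [← funcCalc_eq_self_of_mem h2 e2 fun t ht => trapezoid_eq_one _ ht]
    rw [← mul_apply_eq_comp, ← D.funcCalc_mul e1 e2, funcCalc_eq_zero hgap (e1.mul e2).cont]
    · rfl
    · intro t ht
      by_cases h3 : t ≤ μ
      · rw [trapezoid_eq_zero hη (a := μ) (Or.inl ?_), mul_zero]
        by_contra h4
        exact ht ⟨(not_le.1 h4).le, by linarith⟩
      · rw [trapezoid_eq_zero hη (b := μ) (Or.inr ?_), zero_mul]
        by_contra h4
        exact ht ⟨by linarith, (not_le.1 h4).le⟩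
  have hsup : D.spectralSubspace α μ ⊔ D.spectralSubspace μ β = D.spectralSubspace α β := by
    refine le_antisymm (sup_le (spectralSubspace_mono le_rfl hβ) (spectralSubspace_mono hα le_rfl))
      fun x hx => ?_
    -- On `[α, β]` this `f` is the indicator function of `[α, μ]` except inside the gap, so `x =
    -- f(D) x + (x - f(D) x)` is the required splitting.
    set f := trapezoid (α - 1) (μ - η / 2) (η / 2) with hfdef
    have hf : IsC0 f := isC0_trapezoid _ _ hη2
    have hf0 : ∀ t, μ ≤ t → f t = 0 := fun t ht => trapezoid_eq_zero hη2 (Or.inr (by linarith))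
    have hf1 : ∀ t, α ≤ t → t ≤ μ - η / 2 → f t = 1 :=
      fun t h1 h2 => trapezoid_eq_one _ ⟨by linarith, h2⟩
    rw [← add_sub_cancel (D.funcCalc f x) x]
    refine Submodule.add_mem_sup (fun g hg hs h1 => ?_) (fun g hg hs h1 => ?_)
    · have hg' := IsC0.of_hasCompactSupport hg hs
      rw [← mul_apply_eq_comp, ← D.funcCalc_mul hg' hf]
      refine funcCalc_congr_of_mem hx (hg'.mul hf) hf fun t ht => ?_
      by_cases h2 : t ≤ μ
      · rw [h1 t ⟨ht.1, h2⟩, one_mul]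
      · rw [hf0 t (not_le.1 h2).le, mul_zero]
    · have hg' := IsC0.of_hasCompactSupport hg hs
      set e := trapezoid α β 1 with hedef
      have he : IsC0 e := isC0_trapezoid _ _ one_pos
      have he1 : ∀ t ∈ Icc α β, e t = 1 := fun t ht => trapezoid_eq_one _ ht
      have hxe := funcCalc_eq_self_of_mem hx he he1
      -- On `[α, β]` the function `g - g f - e + f` can be nonzero only in `[μ - η / 2, μ]`. There
      -- `c = 1`, and `c` is supported in the gap.
      set c := trapezoid (μ - η / 2) μ (η / 2) with hcdef
      have hc : IsC0 c := isC0_trapezoid _ _ hη2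
      have hk : IsC0 fun t => (g t - g t * f t - e t + f t) * c t :=
        (((hg'.sub (hg'.mul hf)).sub he).add hf).mul hc
      have hk0 : D.funcCalc (fun t => (g t - g t * f t - e t + f t) * c t) = 0 := by
        refine funcCalc_eq_zero hgap hk.cont fun t ht => ?_
        rw [hcdef, trapezoid_eq_zero_of_notMem hη2, mul_zero]
        intro h2
        exact ht ⟨by linarith [h2.1], by linarith [h2.2]⟩
      have h2 : D.funcCalc (fun t => g t - g t * f t - e t + f t) x = 0 := by
        rw [funcCalc_congr_of_mem hx (((hg'.sub (hg'.mul hf)).sub he).add hf) hk fun t ht => ?_,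
          hk0]
        · rfl
        · by_cases h3 : μ ≤ t
          · rw [hf0 t h3, h1 t ⟨h3, ht.2⟩, he1 t ht]; ring
          · by_cases h4 : t ≤ μ - η / 2
            · rw [hf1 t ht.1 h4, he1 t ht]; ring
            · rw [hcdef, trapezoid_eq_one _ ⟨(not_le.1 h4).le, (not_le.1 h3).le⟩, mul_one]
      rw [D.funcCalc_add ((hg'.sub (hg'.mul hf)).sub he) hf, D.funcCalc_sub (hg'.sub (hg'.mul hf)) he,
        D.funcCalc_sub hg' (hg'.mul hf), D.funcCalc_mul hg' hf, add_apply, sub_apply, sub_apply,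
        hxe, mul_apply_eq_comp] at h2
      rw [map_sub, ← sub_eq_zero, ← h2]
      abel
  have h1 : FiniteDimensional ℂ (D.spectralSubspace α μ) :=
    Submodule.finiteDimensional_of_le (spectralSubspace_mono le_rfl hβ)
  have h2 : FiniteDimensional ℂ (D.spectralSubspace μ β) :=
    Submodule.finiteDimensional_of_le (spectralSubspace_mono hα le_rfl)
  rw [← Submodule.finrank_sup_add_finrank_inf_eq, hinf, hsup]
  simp

end SelfAdjointOp

namespace SelfAdjointOp

/-! ### Fredholm operators -/

variable {D : SelfAdjointOp H} {α β : ℝ}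

theorem funcCalc_apply_mem {x : H} (hx : x ∈ D.spectralSubspace α β) {f : ℝ → ℝ} (hf : IsC0 f) :
    D.funcCalc f x ∈ D.spectralSubspace α β := by
  intro g hg hs h1
  have hg' := IsC0.of_hasCompactSupport hg hs
  have h2 : D.funcCalc g * D.funcCalc f = D.funcCalc f * D.funcCalc g := by
    rw [← D.funcCalc_mul hg' hf, ← D.funcCalc_mul hf hg']
    congr 1; ext t; ring
  rw [← mul_apply_eq_comp, h2, mul_apply_eq_comp, hx g hg hs h1]

theorem isC0_inv_sqrt : IsC0 fun t : ℝ => (Real.sqrt (1 + t ^ 2))⁻¹ := by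
  have h0 : ∀ t : ℝ, 0 < Real.sqrt (1 + t ^ 2) := fun t => Real.sqrt_pos.2 (by positivity)
  refine isC0_of_le_inv (Continuous.inv₀ (by fun_prop) fun t => (h0 t).ne') 0 fun t => ?_
  rw [abs_inv, abs_of_pos (h0 t), sub_zero, inv_mul_le_one₀ (h0 t)]
  exact Real.abs_le_sqrt (by linarith)

/-- Let `G F = 1 + K` with `K` of finite rank. On the spectral subspace of `[-ε, ε]` one has `‖F x‖
≤ ε ‖x‖`, so `K x = 0` gives `‖x‖ ≤ ‖G‖ ε ‖x‖` and `x = 0` for small `ε`: `K` is injective there. -/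
theorem IsFredholm.exists_finiteDimensional (h : D.IsFredholm) :
    ∃ ε > 0, FiniteDimensional ℂ (D.spectralSubspace (-ε) ε) := by
  obtain ⟨F, hF, hFr⟩ := h
  obtain ⟨G, hG⟩ := hFr.exists_isQuasiInverse
  set K : H →ₗ[ℂ] H := (G : H →ₗ[ℂ] H) ∘ₗ (F : H →ₗ[ℂ] H) - LinearMap.id with hK
  have hfin : FiniteDimensional ℂ (LinearMap.range K) := by
    have h1 := LinearMap.FiniteRangeSetoid.equiv_iff_hasFiniteRange.1 hG.1
    exact Module.Finite.iff_fg.2 h1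
  refine ⟨1 / (‖G‖ + 1), by positivity, ?_⟩
  set ε := 1 / (‖G‖ + 1) with hε
  have hε0 : 0 < ε := by positivity
  refine FiniteDimensional.of_injective
    (K.rangeRestrict ∘ₗ (D.spectralSubspace (-ε) ε).subtype) ?_
  rw [← LinearMap.ker_eq_bot, LinearMap.ker_eq_bot']
  rintro ⟨x, hx⟩ h0
  have h1 : G (F x) = x := by
    have h2 : K x = 0 := congrArg Subtype.val h0
    exact sub_eq_zero.1 h2
  obtain ⟨h2, h3⟩ := norm_op_sub_le (funcCalc_apply_mem hx isC0_inv_sqrt) (μ := 0) hε0.le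
    fun t ht => by rw [sub_zero]; exact abs_le.2 ht
  obtain ⟨h4, h5⟩ := hF x
  rw [h5, Complex.ofReal_zero, zero_smul, sub_zero] at h3
  have h6 : ‖D.funcCalc (fun t => (Real.sqrt (1 + t ^ 2))⁻¹) x‖ ≤ 1 * ‖x‖ := by
    refine norm_funcCalc_apply_le hx isC0_inv_sqrt zero_le_one fun t _ => ?_
    have h0 : 1 ≤ Real.sqrt (1 + t ^ 2) := Real.one_le_sqrt.2 (by nlinarith)
    rw [abs_inv, abs_of_pos (by linarith)]
    exact inv_le_one_of_one_le₀ h0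
  rw [one_mul] at h6
  have h7 : ‖x‖ ≤ ‖G‖ * (ε * ‖x‖) := by
    calc ‖x‖ = ‖G (F x)‖ := by rw [h1]
      _ ≤ ‖G‖ * ‖F x‖ := G.le_opNorm _
      _ ≤ ‖G‖ * (ε * ‖x‖) := by gcongr; exact h3.trans (by gcongr)
  apply Subtype.ext
  change x = 0
  by_contra hx0
  have h8 : 0 < ‖x‖ := norm_pos_iff.2 hx0
  have h9 : ‖G‖ * (ε * ‖x‖) < ‖x‖ := by
    rw [← mul_assoc, hε, mul_one_div]
    refine mul_lt_of_lt_one_left h8 ?_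
    rw [div_lt_one (by positivity)]
    linarith
  linarith

/-- For a Fredholm operator `0` is at most an isolated point of the spectrum. -/
theorem IsFredholm.exists_stable (h : D.IsFredholm) :
    ∃ ε > 0, FiniteDimensional ℂ (D.spectralSubspace (-ε) ε) ∧
      ∀ δ, 0 < δ → δ ≤ ε → D.spectralSubspace (-δ) δ = D.spectralSubspace (-ε) ε := by
  obtain ⟨ε, hε, hfin⟩ := h.exists_finiteDimensional
  -- The subspaces shrink with `δ`; where the least dimension is attained they stop shrinking.
  let s : Set ℕ := {k | ∃ δ, 0 < δ ∧ δ ≤ ε ∧ Module.finrank ℂ (D.spectralSubspace (-δ) δ) = k}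
  have hs : s.Nonempty := ⟨_, ε, hε, le_rfl, rfl⟩
  obtain ⟨ε', h1, h2, h3⟩ := Nat.sInf_mem hs
  have hf : FiniteDimensional ℂ (D.spectralSubspace (-ε') ε') :=
    Submodule.finiteDimensional_of_le (spectralSubspace_mono (neg_le_neg h2) h2)
  refine ⟨ε', h1, hf, fun δ h4 h5 => ?_⟩
  refine Submodule.eq_of_le_of_finrank_le (spectralSubspace_mono (neg_le_neg h5) h5) ?_
  rw [h3]
  exact Nat.sInf_le ⟨δ, h4, h5.trans h2, rfl⟩

end SelfAdjointOp

/-! ### Cutoff functions -/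

namespace IsCutoff

variable {φ : ℝ → ℝ}

theorem eq_zero (hφ : IsCutoff φ) {t : ℝ} (ht : 1 ≤ |t|) : φ t = 0 := by
  have h1 : ∀ t < (-1 : ℝ), φ t = 0 := fun t ht => by
    by_contra h
    have := subset_tsupport φ h
    rw [hφ.tsupport_eq] at this
    linarith [this.1]
  have h2 : ∀ t ≤ (-1 : ℝ), φ t = 0 := fun t ht => by
    have h3 : IsClosed {t | φ t = 0} := isClosed_eq hφ.smooth.continuous continuous_const
    have h4 : Iic (-1 : ℝ) ⊆ {t | φ t = 0} := by
      rw [← closure_Iio]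
      exact h3.closure_subset_iff.2 h1
    exact h4 ht
  rcases le_abs'.1 ht with h | h
  · exact h2 t h
  · rw [← hφ.even]; exact h2 _ (by linarith)

theorem strictMonoOn (hφ : IsCutoff φ) : StrictMonoOn φ (Icc (-1) 0) :=
  strictMonoOn_of_deriv_pos (convex_Icc _ _) hφ.smooth.continuous.continuousOn fun x hx =>
    hφ.deriv_pos x (by rwa [interior_Icc] at hx)

theorem apply_neg_abs (hφ : IsCutoff φ) (t : ℝ) : φ (-|t|) = φ t := by
  rcases abs_cases t with h | h <;> rw [h.1]
  · exact hφ.even t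
  · rw [neg_neg]

theorem anti (hφ : IsCutoff φ) {s t : ℝ} (h : |s| ≤ |t|) (ht : |t| ≤ 1) : φ t ≤ φ s := by
  rw [← hφ.apply_neg_abs t, ← hφ.apply_neg_abs s]
  exact hφ.strictMonoOn.monotoneOn ⟨by linarith, by linarith [abs_nonneg t]⟩
    ⟨by linarith, by linarith [abs_nonneg s]⟩ (by linarith)

theorem pos (hφ : IsCutoff φ) {t : ℝ} (ht : |t| < 1) : 0 < φ t := by
  rw [← hφ.apply_neg_abs t, ← hφ.eq_zero (t := -1) (by simp)]
  exact hφ.strictMonoOn ⟨le_rfl, by linarith⟩ ⟨by linarith, by linarith [abs_nonneg t]⟩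
    (by linarith)

theorem scaled_eq_zero (hφ : IsCutoff φ) (n : ℕ+) {t : ℝ} (ht : 1 / (n : ℝ) ≤ |t|) :
    φ ((n : ℝ) * t) = 0 := by
  have hn : (0 : ℝ) < n := by exact_mod_cast n.pos
  refine hφ.eq_zero ?_
  rw [abs_mul, abs_of_pos hn]
  rwa [div_le_iff₀' hn] at ht

theorem scaled_eq_zero_of_notMem (hφ : IsCutoff φ) (n : ℕ+) {t : ℝ}
    (ht : t ∉ Icc (-(1 / (n : ℝ))) (1 / n)) : φ ((n : ℝ) * t) = 0 := by
  refine hφ.scaled_eq_zero n ?_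
  by_contra h
  exact ht (abs_le.1 (not_le.1 h).le)

theorem isC0_scaled (hφ : IsCutoff φ) (n : ℕ+) : IsC0 fun t => φ ((n : ℝ) * t) :=
  .of_eq_zero (hφ.smooth.continuous.comp (continuous_const.mul continuous_id))
    fun _ => hφ.scaled_eq_zero_of_notMem n

/-- A continuous function whose support is contained in the interior of that of `φ_n` is a multiple
of `φ_n`. -/
theorem exists_factor (hφ : IsCutoff φ) (n : ℕ+) {c : ℝ} (hc : 0 ≤ c) (hcn : c < 1 / (n : ℝ))
    {f : ℝ → ℝ} (hf : Continuous f) (hf0 : ∀ t, t ∉ Icc (-c) c → f t = 0) :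
    ∃ k, IsC0 k ∧ f = fun t => k t * φ ((n : ℝ) * t) := by
  have hn : (0 : ℝ) < n := by exact_mod_cast n.pos
  have hnc : |(n : ℝ) * c| < 1 := by
    rw [abs_mul, abs_of_pos hn, abs_of_nonneg hc]
    rwa [lt_div_iff₀' hn] at hcn
  have hm := hφ.pos hnc
  have hm0 : ∀ t, 0 < max (φ ((n : ℝ) * t)) (φ (n * c)) := fun t => lt_max_of_lt_right hm
  -- The floor `φ(n c) > 0` keeps the quotient continuous; by monotonicity it is inactive on `[-c,
  -- c]`, where `f` lives.
  refine ⟨fun t => f t / max (φ ((n : ℝ) * t)) (φ (n * c)), .of_eq_zero (a := -c) (b := c) ?_ ?_, ?_⟩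
  · exact hf.div ((hφ.isC0_scaled n).cont.max continuous_const) fun t => (hm0 t).ne'
  · intro t ht
    rw [hf0 t ht, zero_div]
  · ext t
    dsimp only
    by_cases ht : t ∈ Icc (-c) c
    · have h1 : max (φ ((n : ℝ) * t)) (φ (n * c)) = φ (n * t) := by
        refine max_eq_left (hφ.anti ?_ hnc.le)
        rw [abs_mul, abs_mul, abs_of_nonneg hc]
        exact mul_le_mul_of_nonneg_left (abs_le.2 ht) (abs_nonneg _)
      have h2 := (hm0 t).ne'
      rw [h1] at h2 ⊢
      rw [div_mul_cancel₀ _ h2]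
    · rw [hf0 t ht, zero_div, zero_mul]

end IsCutoff

/-! ### Norm continuity -/

omit [CompleteSpace H] in
-- Bounded strong convergence is uniform on compact sets, so `A i * B₀ → A₀ * B₀` in norm; the rest
-- `A i * (B i - B₀)` is controlled by the bound on `A i`.
theorem tendsto_mul_of_isCompactOperator {ι : Type*} {l : Filter ι} {A B : ι → H →L[ℂ] H}
    {A₀ B₀ : H →L[ℂ] H} {C : ℝ} (hC : ∀ i, ‖A i‖ ≤ C) (hC₀ : ‖A₀‖ ≤ C)
    (hA : ∀ x, Tendsto (fun i => A i x) l (𝓝 (A₀ x))) (hB : Tendsto B l (𝓝 B₀))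
    (hB₀ : IsCompactOperator B₀) : Tendsto (fun i => A i * B i) l (𝓝 (A₀ * B₀)) := by
  have hC' : 0 ≤ C := (norm_nonneg _).trans hC₀
  have h1 : Tendsto (fun i => A i * B₀) l (𝓝 (A₀ * B₀)) := by
    rw [Metric.tendsto_nhds]
    intro ε hε
    obtain ⟨S, hS, hS'⟩ := hB₀.image_closedBall_subset_compact (𝕜₁ := ℂ) 1
    set δ := ε / (4 * (C + 1)) with hδ
    have hδ0 : 0 < δ := by positivity
    obtain ⟨t, -, htf, ht⟩ := hS.finite_cover_balls hδ0
    have h2 : ∀ᶠ i in l, ∀ y ∈ t, ‖A i y - A₀ y‖ < δ := by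
      rw [htf.eventually_all]
      intro y _
      have := Metric.tendsto_nhds.1 (hA y) δ hδ0
      simpa [dist_eq_norm] using this
    filter_upwards [h2] with i hi
    rw [dist_eq_norm, ← sub_mul]
    have h3 : ‖(A i - A₀) * B₀‖ ≤ ε / 2 := by
      refine ContinuousLinearMap.opNorm_le_of_unit_norm (𝕜 := ℂ) (by positivity) fun x hx => ?_
      have h4 : B₀ x ∈ S := hS' ⟨x, by simp [hx], rfl⟩
      obtain ⟨y, hy, hxy⟩ := mem_iUnion₂.1 (ht h4)
      rw [Metric.mem_ball, dist_eq_norm] at hxy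
      have h5 : (A i - A₀) (B₀ x) = (A i - A₀) (B₀ x - y) + (A i y - A₀ y) := by
        rw [map_sub, sub_apply (A i) A₀ y]; abel
      have h6 : ‖A i - A₀‖ ≤ C + C := (norm_sub_le _ _).trans (add_le_add (hC i) hC₀)
      calc ‖((A i - A₀) * B₀) x‖ = ‖(A i - A₀) (B₀ x - y) + (A i y - A₀ y)‖ := by rw [← h5]; rfl
        _ ≤ (C + C) * δ + δ := (norm_add_le _ _).trans (add_le_add
            (((A i - A₀).le_of_opNorm_le h6 _).trans (by gcongr)) (hi y hy).le)
        _ ≤ 2 * (C + 1) * δ := by linarith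
        _ = ε / 2 := by rw [hδ]; field_simp; norm_num
    linarith
  have h2 : Tendsto (fun i => A i * (B i - B₀)) l (𝓝 0) := by
    have h3 : Tendsto (fun i => C * ‖B i - B₀‖) l (𝓝 0) := by
      have h3 := (tendsto_iff_norm_sub_tendsto_zero.1 hB).const_mul C
      rwa [mul_zero] at h3
    refine squeeze_zero_norm (fun i => ?_) h3
    exact (norm_mul_le _ _).trans (by gcongr; exact hC i)
  have h3 := h1.add h2
  rw [add_zero] at h3
  refine h3.congr fun i => ?_
  rw [mul_sub]; abel

/-- A family of selfadjoint operators that is continuous in the strong resolvent sense. -/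
structure StronglyContinuous {X : Type*} [TopologicalSpace X] (D : X → SelfAdjointOp H) : Prop where
  neg : ∀ x, Continuous fun t => (D t).resolvent (-Complex.I) x
  pos : ∀ x, Continuous fun t => (D t).resolvent Complex.I x

theorem StronglyContinuous.comp {X Y : Type*} [TopologicalSpace X] [TopologicalSpace Y]
    {D : X → SelfAdjointOp H} (hD : StronglyContinuous D) {g : Y → X} (hg : Continuous g) :
    StronglyContinuous fun y => D (g y) :=
  ⟨fun x => (hD.neg x).comp hg, fun x => (hD.pos x).comp hg⟩

theorem StronglyContinuous.continuous_funcCalc {X : Type*} [TopologicalSpace X]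
    {D : X → SelfAdjointOp H} (hD : StronglyContinuous D) {f : ℝ → ℝ} (hf : IsC0 f) (x : H) :
    Continuous fun t => (D t).funcCalc f x :=
  continuous_iff_continuousAt.2 fun t =>
    SelfAdjointOp.tendsto_funcCalc (fun x => (hD.neg x).tendsto t) (fun x => (hD.pos x).tendsto t) hf x

theorem continuous_funcCalc_of_cutoffOp {X : Type*} [TopologicalSpace X]
    {D : X → SelfAdjointOp H} (hD : StronglyContinuous D) {φ : ℝ → ℝ} (hφ : IsCutoff φ) {n : ℕ+}
    (hn : Continuous fun t => (D t).cutoffOp φ n)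
    (hcomp : ∀ t, IsCompactOperator ((D t).cutoffOp φ n)) {c : ℝ} (hc : 0 ≤ c)
    (hcn : c < 1 / (n : ℝ)) {f : ℝ → ℝ} (hf : Continuous f)
    (hf0 : ∀ t, t ∉ Icc (-c) c → f t = 0) : Continuous fun t => (D t).funcCalc f := by
  obtain ⟨k, hk, rfl⟩ := hφ.exists_factor n hc hcn hf hf0
  obtain ⟨C, hC, hCk⟩ := hk.exists_bound
  have h1 : ∀ D : SelfAdjointOp H, D.funcCalc (fun t => k t * φ ((n : ℝ) * t)) =
      D.funcCalc k * D.cutoffOp φ n := fun D => D.funcCalc_mul hk (hφ.isC0_scaled n)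
  simp only [h1]
  exact continuous_iff_continuousAt.2 fun t => tendsto_mul_of_isCompactOperator (C := C)
    (fun i => (D i).norm_funcCalc_le hC hCk) ((D t).norm_funcCalc_le hC hCk)
    (fun x => (hD.continuous_funcCalc hk x).tendsto t) (hn.tendsto t) (hcomp t)

/-! ### The topologies -/

variable {φ : ℝ → ℝ}

theorem continuous_fredholmLevel_iff {X : Type*} [TopologicalSpace X] {n : ℕ+}
    {E : X → FredholmLevel φ n H} : Continuous E ↔
      StronglyContinuous (fun t => (E t).1) ∧ Continuous fun t => (E t).1.cutoffOp φ n := by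
  rw [continuous_induced_rng, continuous_inf_rng, continuous_inf_rng, continuous_iInf_rng,
    continuous_iInf_rng, continuous_induced_rng]
  simp only [continuous_induced_rng]
  exact ⟨fun h => ⟨⟨h.1.1, h.1.2⟩, h.2⟩, fun h => ⟨⟨h.1.1, h.1.2⟩, h.2⟩⟩

theorem stronglyContinuous_fredholmLevel (n : ℕ+) :
    StronglyContinuous fun D : FredholmLevel φ n H => D.1 :=
  (continuous_fredholmLevel_iff.1 continuous_id).1

theorem continuous_cutoffOp (n : ℕ+) : Continuous fun D : FredholmLevel φ n H => D.1.cutoffOp φ n :=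
  (continuous_fredholmLevel_iff.1 continuous_id).2

theorem stronglyContinuous_fredholmSpace :
    StronglyContinuous fun D : FredholmSpace φ H => D.1 :=
  ⟨fun x => continuous_iSup_dom.2 fun n => continuous_coinduced_dom.2
      ((stronglyContinuous_fredholmLevel n).neg x),
    fun x => continuous_iSup_dom.2 fun n => continuous_coinduced_dom.2
      ((stronglyContinuous_fredholmLevel n).pos x)⟩

theorem isOpen_fredholmSpace_iff {s : Set (FredholmSpace φ H)} :
    IsOpen s ↔ ∀ n : ℕ+, IsOpen (FredholmLevel.incl φ n ⁻¹' s) := by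
  rw [isOpen_iSup_iff]
  rfl

/-! ### Finite dimensional subspaces -/

omit [CompleteSpace H] in
theorem finrank_le_of_injOn {U V : Submodule ℂ H} [FiniteDimensional ℂ V] (T : H →L[ℂ] H)
    (hT : ∀ x ∈ U, T x ∈ V) (h0 : ∀ x ∈ U, T x = 0 → x = 0) :
    Module.finrank ℂ U ≤ Module.finrank ℂ V := by
  refine LinearMap.finrank_le_finrank_of_injective
    (f := LinearMap.restrict (T : H →ₗ[ℂ] H) (p := U) (q := V) hT) ?_
  rw [← LinearMap.ker_eq_bot, LinearMap.ker_eq_bot']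
  rintro ⟨x, hx⟩ h
  exact Subtype.ext (h0 x hx (congrArg Subtype.val h))

omit [CompleteSpace H] in
theorem isCompactOperator_of_mem {V : Submodule ℂ H} [FiniteDimensional ℂ V] (T : H →L[ℂ] H)
    (hT : ∀ x, T x ∈ V) : IsCompactOperator T := by
  have : ProperSpace V := FiniteDimensional.proper ℂ V
  have h1 : IsCompactOperator (T.codRestrict V hT) :=
    isCompactOperator_of_locallyCompactSpace_dom (T.codRestrict V hT)
  exact h1.clm_comp V.subtypeL

omit [InnerProductSpace ℂ H] [CompleteSpace H] in
theorem eq_zero_of_norm_le {x y : H} {c : ℝ} (hc : c < 1) (h : ‖y - x‖ ≤ c * ‖x‖) (hy : y = 0) :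
    x = 0 := by
  rw [hy, zero_sub, norm_neg] at h
  by_contra hx
  have := norm_pos_iff.2 hx
  nlinarith

omit [CompleteSpace H] in
-- The orthogonal projection onto `V` is compact, so `A i` converges in norm after composition with
-- it.
theorem eventually_norm_sub_le {ι : Type*} {l : Filter ι} {A : ι → H →L[ℂ] H}
    {A₀ : H →L[ℂ] H} {C : ℝ} (hC : ∀ i, ‖A i‖ ≤ C) (hC₀ : ‖A₀‖ ≤ C)
    (hA : ∀ x, Tendsto (fun i => A i x) l (𝓝 (A₀ x))) (V : Submodule ℂ H) [FiniteDimensional ℂ V]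
    {ε : ℝ} (hε : 0 < ε) : ∀ᶠ i in l, ∀ x ∈ V, ‖A i x - A₀ x‖ ≤ ε * ‖x‖ := by
  have h1 := tendsto_mul_of_isCompactOperator hC hC₀ hA (tendsto_const_nhds (x := V.starProjection))
    (isCompactOperator_of_mem (V := V) V.starProjection fun x => V.starProjection_apply_mem x)
  filter_upwards [Metric.tendsto_nhds.1 h1 ε hε] with i hi x hx
  rw [dist_eq_norm, ← sub_mul] at hi
  have h2 := ((A i - A₀) * V.starProjection).le_of_opNorm_le hi.le x
  rwa [mul_apply_eq_comp, Submodule.starProjection_eq_self_iff.2 hx, sub_apply] at h2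

/-- A strongly continuous family of orthogonal projections of the same finite rank is norm
continuous. -/
theorem continuous_of_finrank_eq {X : Type*} [TopologicalSpace X] {Q : X → H →L[ℂ] H} {r : ℕ}
    (hQ : ∀ x, Q x * Q x = Q x) (hs : ∀ x, star (Q x) = Q x) (hn : ∀ x, ‖Q x‖ ≤ 1)
    (hfin : ∀ x, FiniteDimensional ℂ (LinearMap.range (Q x : H →ₗ[ℂ] H)))
    (hr : ∀ x, Module.finrank ℂ (LinearMap.range (Q x : H →ₗ[ℂ] H)) = r)
    (hc : ∀ v, Continuous fun x => Q x v) : Continuous Q := by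
  refine continuous_iff_continuousAt.2 fun x₁ => ?_
  have hfix : ∀ x, ∀ w ∈ LinearMap.range (Q x : H →ₗ[ℂ] H), Q x w = w := by
    rintro x _ ⟨v, rfl⟩
    change (Q x * Q x) v = Q x v
    rw [hQ]
  have h2 : ‖1 - Q x₁‖ ≤ 2 := by
    refine (norm_sub_le _ _).trans ?_
    have : ‖(1 : H →L[ℂ] H)‖ ≤ 1 := ContinuousLinearMap.norm_id_le
    linarith [hn x₁]
  rw [ContinuousAt, Metric.tendsto_nhds]
  intro ε hε
  -- The bound `1 / 2` gives injectivity on the range of `Q x₁`; the final error is `4 e + e < ε`.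
  set e := min (1 / 2) (ε / 6) with he
  have he0 : 0 < e := lt_min (by norm_num) (by positivity)
  filter_upwards [eventually_norm_sub_le hn (hn x₁) (fun v => (hc v).tendsto x₁)
    (LinearMap.range (Q x₁ : H →ₗ[ℂ] H)) he0] with x hx
  have h3 : ∀ w ∈ LinearMap.range (Q x₁ : H →ₗ[ℂ] H), ‖Q x w - w‖ ≤ e * ‖w‖ := fun w hw => by
    have := hx w hw
    rwa [hfix x₁ w hw] at this
  have he2 : e ≤ 1 / 2 := min_le_left _ _
  let T : LinearMap.range (Q x₁ : H →ₗ[ℂ] H) →ₗ[ℂ] LinearMap.range (Q x : H →ₗ[ℂ] H) :=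
    LinearMap.restrict (Q x : H →ₗ[ℂ] H) fun w _ => ⟨w, rfl⟩
  -- Equal ranks enter here: `Q x` is injective on the range of `Q x₁`, hence maps it onto the range
  -- of `Q x`.
  have hT : Function.Surjective T := by
    rw [← LinearMap.injective_iff_surjective_of_finrank_eq_finrank ((hr x₁).trans (hr x).symm),
      ← LinearMap.ker_eq_bot, LinearMap.ker_eq_bot']
    rintro ⟨w, hw⟩ h
    exact Subtype.ext (eq_zero_of_norm_le (by linarith) (h3 w hw) (congrArg Subtype.val h))
  have h4 : ‖(1 - Q x₁) * Q x‖ ≤ 4 * e := by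
    refine ContinuousLinearMap.opNorm_le_bound _ (by positivity) fun y => ?_
    obtain ⟨⟨w, hw⟩, hwy⟩ := hT ⟨Q x y, y, rfl⟩
    have hwy' : Q x w = Q x y := congrArg Subtype.val hwy
    have h5 := h3 w hw
    have h6 : ‖w‖ ≤ 2 * ‖y‖ := by
      have h7 : ‖w‖ ≤ ‖Q x w‖ + ‖Q x w - w‖ := by
        calc ‖w‖ = ‖Q x w - (Q x w - w)‖ := by congr 1; abel
          _ ≤ _ := norm_sub_le _ _
      have h8 : ‖Q x w‖ ≤ 1 * ‖y‖ := by rw [hwy']; exact (Q x).le_of_opNorm_le (hn x) y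
      nlinarith [norm_nonneg w]
    have h7 : ((1 - Q x₁) * Q x) y = (1 - Q x₁) (Q x w - w) := by
      rw [mul_apply_eq_comp, ← hwy', map_sub, sub_apply 1 (Q x₁) w, hfix x₁ w hw]
      simp
    rw [h7]
    calc ‖(1 - Q x₁) (Q x w - w)‖ ≤ 2 * (e * ‖w‖) :=
          ((1 - Q x₁).le_of_opNorm_le h2 _).trans (by gcongr)
      _ ≤ 2 * (e * (2 * ‖y‖)) := by gcongr
      _ = 4 * e * ‖y‖ := by ring
  have h5 : ‖Q x * (1 - Q x₁)‖ ≤ 4 * e := by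
    have h6 : star ((1 - Q x₁) * Q x) = Q x * (1 - Q x₁) := by
      rw [star_mul, star_sub, star_one, hs, hs]
    rwa [← h6, norm_star]
  have h6 : ‖(1 - Q x) * Q x₁‖ ≤ e := by
    refine ContinuousLinearMap.opNorm_le_bound _ he0.le fun y => ?_
    have h7 := h3 (Q x₁ y) ⟨y, rfl⟩
    have h8 : ((1 - Q x) * Q x₁) y = -(Q x (Q x₁ y) - Q x₁ y) := by
      rw [mul_apply_eq_comp, sub_apply]; simp
    rw [h8, norm_neg]
    refine h7.trans ?_
    have := (Q x₁).le_of_opNorm_le (hn x₁) y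
    rw [one_mul] at this
    gcongr
  have h7 : Q x - Q x₁ = Q x * (1 - Q x₁) - (1 - Q x) * Q x₁ := by noncomm_ring
  rw [dist_eq_norm, h7]
  have h8 : e ≤ ε / 6 := min_le_right _ _
  exact (norm_sub_le _ _).trans_lt (by linarith)

/-! ### Constancy of the dimension of spectral subspaces -/

-- The outer trapezoid `f₁` is `1` on `[α, β]`, the inner one `f₂` is supported there, and they
-- differ only in the gaps of `D x₁`, so `f₁(D x₁) = f₂(D x₁)`. By norm continuity, for `x` near
-- `x₁`, `f₂(D x₁)` is injective on the spectral subspace of `D x` and `f₂(D x)` on that of `D x₁`.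
open SelfAdjointOp in
theorem eventually_finrank_eq {X : Type*} [TopologicalSpace X] {D : X → SelfAdjointOp H} {c : ℝ}
    (hD : ∀ f : ℝ → ℝ, Continuous f → (∀ t, t ∉ Icc (-c) c → f t = 0) →
      Continuous fun x => (D x).funcCalc f)
    {α β : ℝ} (hα : -c < α) (hαβ : α < β) (hβ : β < c) (x₁ : X)
    (h1 : (D x₁).InResolventSet (α : ℂ)) (h2 : (D x₁).InResolventSet (β : ℂ))
    (hfin : ∀ x, FiniteDimensional ℂ ((D x).spectralSubspace α β)) :
    ∀ᶠ x in 𝓝 x₁, Module.finrank ℂ ((D x).spectralSubspace α β) =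
      Module.finrank ℂ ((D x₁).spectralSubspace α β) := by
  obtain ⟨ηα, hηα, gα⟩ := exists_gap h1
  obtain ⟨ηβ, hηβ, gβ⟩ := exists_gap h2
  set η := min (min ηα ηβ) (min (min (c + α) (c - β)) ((β - α) / 2)) with hη
  have hη0 : 0 < η := by
    refine lt_min (lt_min hηα hηβ) (lt_min (lt_min ?_ ?_) ?_) <;> linarith
  have hη1 : η ≤ ηα := (min_le_left _ _).trans (min_le_left _ _)
  have hη2 : η ≤ ηβ := (min_le_left _ _).trans (min_le_right _ _)
  have hη3 : η ≤ c + α := (min_le_right _ _).trans ((min_le_left _ _).trans (min_le_left _ _))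
  have hη4 : η ≤ c - β := (min_le_right _ _).trans ((min_le_left _ _).trans (min_le_right _ _))
  have hη5 : η ≤ (β - α) / 2 := (min_le_right _ _).trans (min_le_right _ _)
  have gα' : (D x₁).spectralSubspace (α - η) (α + η) = ⊥ :=
    le_bot_iff.1 (gα ▸ spectralSubspace_mono (by linarith) (by linarith))
  have gβ' : (D x₁).spectralSubspace (β - η) (β + η) = ⊥ :=
    le_bot_iff.1 (gβ ▸ spectralSubspace_mono (by linarith) (by linarith))
  set f₁ := trapezoid α β η with hf₁
  set f₂ := trapezoid (α + η) (β - η) η with hf₂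
  have i₁ : IsC0 f₁ := isC0_trapezoid _ _ hη0
  have i₂ : IsC0 f₂ := isC0_trapezoid _ _ hη0
  have z₁ : ∀ t, t ≤ α - η ∨ β + η ≤ t → f₁ t = 0 := fun t ht => trapezoid_eq_zero hη0 ht
  have z₂ : ∀ t, t ≤ α ∨ β ≤ t → f₂ t = 0 := fun t ht => trapezoid_eq_zero hη0
    (ht.imp (fun h => by linarith) fun h => by linarith)
  have o₁ : ∀ t ∈ Icc α β, f₁ t = 1 := fun t ht => trapezoid_eq_one _ ht
  have o₂ : ∀ t ∈ Icc (α + η) (β - η), f₂ t = 1 := fun t ht => trapezoid_eq_one _ ht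
  have z₂' : ∀ t, t ∉ Icc α β → f₂ t = 0 := fun t ht => z₂ t (by
    by_contra h
    push Not at h
    exact ht ⟨h.1.le, h.2.le⟩)
  have hP : (D x₁).funcCalc f₁ = (D x₁).funcCalc f₂ := by
    -- Cutting `f₁ - f₂` at the midpoint, where it vanishes, leaves one bump in each gap.
    set m := (α + β) / 2 with hm
    set g := fun t => f₁ t - f₂ t with hg
    have gc : Continuous g := i₁.cont.sub i₂.cont
    have g0 : ∀ t, t ≤ α - η ∨ β + η ≤ t ∨ t ∈ Icc (α + η) (β - η) → g t = 0 := by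
      rintro t (h | h | h)
      · simp only [hg]
        rw [z₁ t (Or.inl h), z₂ t (Or.inl (by linarith)), sub_zero]
      · simp only [hg]
        rw [z₁ t (Or.inr h), z₂ t (Or.inr (by linarith)), sub_zero]
      · simp only [hg]
        rw [o₁ t ⟨by linarith [h.1], by linarith [h.2]⟩, o₂ t h, sub_self]
    have c1 : Continuous fun t => g (min t m) := gc.comp (continuous_id.min continuous_const)
    have c2 : Continuous fun t => g (max t m) := gc.comp (continuous_id.max continuous_const)
    have e1 : ∀ t, t ∉ Icc (α - η) (α + η) → g (min t m) = 0 := by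
      intro t ht
      by_cases h : t < α - η
      · exact g0 _ (Or.inl ((min_le_left _ _).trans h.le))
      · have h' : α + η < t := by
          by_contra h''
          exact ht ⟨not_lt.1 h, not_lt.1 h''⟩
        exact g0 _ (Or.inr (Or.inr ⟨le_min h'.le (by linarith), (min_le_right _ _).trans (by linarith)⟩))
    have e2 : ∀ t, t ∉ Icc (β - η) (β + η) → g (max t m) = 0 := by
      intro t ht
      by_cases h : β + η < t
      · exact g0 _ (Or.inr (Or.inl (h.le.trans (le_max_left _ _))))
      · have h' : t < β - η := by
          by_contra h''
          exact ht ⟨not_lt.1 h'', not_lt.1 h⟩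
        exact g0 _ (Or.inr (Or.inr ⟨le_trans (by linarith) (le_max_right _ _), max_le h'.le (by linarith)⟩))
    have hsum : g = fun t => g (min t m) + g (max t m) := by
      ext t
      have hm0 : g m = 0 := g0 m (Or.inr (Or.inr ⟨by linarith, by linarith⟩))
      rcases le_total t m with h | h
      · rw [min_eq_left h, max_eq_right h, hm0, add_zero]
      · rw [min_eq_right h, max_eq_left h, hm0, zero_add]
    rw [← sub_eq_zero, ← (D x₁).funcCalc_sub i₁ i₂]
    change (D x₁).funcCalc g = 0
    rw [hsum, (D x₁).funcCalc_add (.of_eq_zero c1 e1) (.of_eq_zero c2 e2),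
      funcCalc_eq_zero gα' c1 e1, funcCalc_eq_zero gβ' c2 e2, add_zero]
  have t₁ := (hD f₁ i₁.cont fun t ht => z₁ t (by
    by_contra h
    push Not at h
    exact ht ⟨by linarith, by linarith⟩)).tendsto x₁
  have t₂ := (hD f₂ i₂.cont fun t ht => z₂ t (by
    by_contra h
    push Not at h
    exact ht ⟨by linarith, by linarith⟩)).tendsto x₁
  filter_upwards [Metric.tendsto_nhds.1 t₁ (1 / 2) (by norm_num),
    Metric.tendsto_nhds.1 t₂ (1 / 2) (by norm_num)] with x hx₁ hx₂
  rw [dist_comm, dist_eq_norm] at hx₁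
  rw [dist_eq_norm] at hx₂
  have := hfin x
  have := hfin x₁
  refine le_antisymm (finrank_le_of_injOn ((D x₁).funcCalc f₂)
      (fun v _ => funcCalc_mem_spectralSubspace i₂ z₂' v) fun v hv h0 => ?_)
    (finrank_le_of_injOn ((D x).funcCalc f₂)
      (fun v _ => funcCalc_mem_spectralSubspace i₂ z₂' v) fun v hv h0 => ?_)
  · rw [← hP] at h0
    refine eq_zero_of_norm_le (c := 1 / 2) (by norm_num) ?_ h0
    have h3 := ((D x₁).funcCalc f₁ - (D x).funcCalc f₁).le_of_opNorm_le hx₁.le v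
    rwa [sub_apply, funcCalc_eq_self_of_mem hv i₁ o₁] at h3
  · refine eq_zero_of_norm_le (c := 1 / 2) (by norm_num) ?_ h0
    have h3 := ((D x).funcCalc f₂ - (D x₁).funcCalc f₂).le_of_opNorm_le hx₂.le v
    rwa [sub_apply, ← hP, funcCalc_eq_self_of_mem hv i₁ o₁] at h3

theorem finrank_eq_of_preconnected {X : Type*} [TopologicalSpace X] [PreconnectedSpace X]
    {D : X → SelfAdjointOp H} {c : ℝ}
    (hD : ∀ f : ℝ → ℝ, Continuous f → (∀ t, t ∉ Icc (-c) c → f t = 0) →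
      Continuous fun x => (D x).funcCalc f)
    {α β : ℝ} (hα : -c < α) (hαβ : α < β) (hβ : β < c)
    (h1 : ∀ x, (D x).InResolventSet (α : ℂ)) (h2 : ∀ x, (D x).InResolventSet (β : ℂ))
    (hfin : ∀ x, FiniteDimensional ℂ ((D x).spectralSubspace α β)) (x y : X) :
    Module.finrank ℂ ((D x).spectralSubspace α β) =
      Module.finrank ℂ ((D y).spectralSubspace α β) := by
  have h : IsLocallyConstant fun x => Module.finrank ℂ ((D x).spectralSubspace α β) :=
    (IsLocallyConstant.iff_eventually_eq _).2 fun x =>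
      eventually_finrank_eq hD hα hαβ hβ x (h1 x) (h2 x) hfin
  exact h.apply_eq_of_preconnectedSpace x y

/-! ### The local structure of continuous families -/

open SelfAdjointOp

theorem pnat_one_div_anti {m n : ℕ+} (h : m ≤ n) : 1 / (n : ℝ) ≤ 1 / (m : ℝ) :=
  one_div_le_one_div_of_le (by exact_mod_cast m.pos) (by exact_mod_cast h)

theorem pnat_one_div_strictAnti {m n : ℕ+} (h : m < n) : 1 / (n : ℝ) < 1 / (m : ℝ) :=
  one_div_lt_one_div_of_lt (by exact_mod_cast m.pos) (by exact_mod_cast h)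

/-- An operator with too much spectrum near `0` is not close to `D₀` with respect to `φ_j`. -/
theorem exists_le_norm_cutoffOp_sub (hφ : IsCutoff φ) (D₀ : SelfAdjointOp H) (j : ℕ+)
    [FiniteDimensional ℂ (D₀.spectralSubspace (-(1 / (j : ℝ))) (1 / j))] :
    ∃ c > 0, ∀ (D : SelfAdjointOp H) (W : Submodule ℂ H),
      W ≤ D.spectralSubspace (-(1 / (j : ℝ) / 2)) (1 / j / 2) → FiniteDimensional ℂ W →
      Module.finrank ℂ (D₀.spectralSubspace (-(1 / (j : ℝ))) (1 / j)) < Module.finrank ℂ W →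
      c ≤ ‖D.cutoffOp φ j - D₀.cutoffOp φ j‖ := by
  have hj0 : (0 : ℝ) < j := by exact_mod_cast j.pos
  have hj : 0 < 1 / (j : ℝ) := by positivity
  set e := 1 / (j : ℝ) with he
  have he4 : 0 < e / 4 := by positivity
  -- `k` inverts `φ_j` on `[-e / 2, e / 2]`. Its bound depends only on `φ` and `j`, which makes the
  -- constant uniform in `D`.
  obtain ⟨k, hk, hkf⟩ := hφ.exists_factor j (c := e / 2 + e / 4) (by positivity)
    (by linarith) (continuous_trapezoid (-(e / 2)) (e / 2) (e / 4))
    fun t ht => trapezoid_eq_zero_of_notMem he4 fun h => ht ⟨by linarith [h.1], by linarith [h.2]⟩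
  obtain ⟨C, hC0, hC⟩ := hk.exists_bound
  refine ⟨1 / (C + 1), by positivity, fun D W hW hfin hlt => ?_⟩
  set V := D₀.spectralSubspace (-e) e with hV
  -- As `W` has larger dimension than `V`, it contains some `v ≠ 0` orthogonal to `V`. Such a `v` is
  -- killed by `φ_j(D₀)`, which is selfadjoint with range in `V`, but `φ_j(D)` is bounded below on
  -- it.
  have hker := LinearMap.ker_ne_bot_of_finrank_lt
    (f := (V.orthogonalProjectionOnto : H →ₗ[ℂ] V) ∘ₗ W.subtype) hlt
  obtain ⟨⟨v, hvW⟩, hv0, hv⟩ := Submodule.exists_mem_ne_zero_of_ne_bot hker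
  have hvV : v ∈ Vᗮ := Submodule.orthogonalProjectionOnto_eq_zero_iff.1 hv0
  have hvne : v ≠ 0 := fun h => hv (Subtype.ext h)
  have h1 : D₀.cutoffOp φ j v = 0 := by
    refine ext_inner_right ℂ fun w => ?_
    rw [cutoffOp, inner_funcCalc_left, inner_zero_left]
    exact Submodule.inner_left_of_mem_orthogonal
      (funcCalc_mem_spectralSubspace (hφ.isC0_scaled j) (fun t => hφ.scaled_eq_zero_of_notMem j) w) hvV
  have h2 : v = D.funcCalc k (D.cutoffOp φ j v) := by
    nth_rw 1 [← funcCalc_eq_self_of_mem (hW hvW) (isC0_trapezoid _ _ he4)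
      fun t ht => trapezoid_eq_one _ ht]
    rw [hkf, D.funcCalc_mul hk (hφ.isC0_scaled j)]
    rfl
  have h3 : ‖v‖ ≤ C * ‖(D.cutoffOp φ j - D₀.cutoffOp φ j) v‖ := by
    rw [sub_apply, h1, sub_zero]
    nth_rw 1 [h2]
    exact (D.funcCalc k).le_of_opNorm_le (D.norm_funcCalc_le hC0 hC) _
  have h4 := (D.cutoffOp φ j - D₀.cutoffOp φ j).le_opNorm v
  have h5 : 0 < ‖v‖ := norm_pos_iff.2 hvne
  rw [div_le_iff₀ (by positivity)]
  set N := ‖D.cutoffOp φ j - D₀.cutoffOp φ j‖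
  have hN : 0 ≤ N := norm_nonneg _
  have h6 : 1 * ‖v‖ ≤ (N * (C + 1)) * ‖v‖ := by
    calc 1 * ‖v‖ ≤ C * (N * ‖v‖) := by rw [one_mul]; exact h3.trans (by gcongr)
      _ = (N * C) * ‖v‖ := by ring
      _ ≤ (N * (C + 1)) * ‖v‖ := by gcongr; linarith
  exact le_of_mul_le_mul_right h6 h5

theorem exists_resolvent_ne {D E : FredholmSpace φ H} (h : D ≠ E) :
    ∃ v, D.1.resolvent (-Complex.I) v ≠ E.1.resolvent (-Complex.I) v := by
  by_contra! h1
  exact h (Subtype.ext (ext_resolvent (ContinuousLinearMap.ext h1)))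

theorem eventually_incl_ne {n : ℕ+} {E : FredholmLevel φ n H} {D : FredholmSpace φ H}
    (h : FredholmLevel.incl φ n E ≠ D) : ∀ᶠ E' in 𝓝 E, FredholmLevel.incl φ n E' ≠ D := by
  obtain ⟨v, hv⟩ := exists_resolvent_ne h
  filter_upwards [((stronglyContinuous_fredholmLevel (φ := φ) n).neg v).tendsto E
    |>.eventually_ne hv] with E' hE' h'
  exact hE' (by rw [← h']; rfl)

theorem continuous_cutoffOp_of_lt (hφ : IsCutoff φ) {n j : ℕ+} (h : n < j) :
    Continuous fun D : FredholmLevel φ n H => D.1.cutoffOp φ j :=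
  continuous_funcCalc_of_cutoffOp (stronglyContinuous_fredholmLevel n) hφ (continuous_cutoffOp n)
    (fun D => D.2.2) (by positivity) (pnat_one_div_strictAnti h) (hφ.isC0_scaled j).cont
    fun _ => hφ.scaled_eq_zero_of_notMem j

/-- In a continuous family the dimension of the spectral subspaces near `0` does not jump up. -/
theorem exists_eventually_finrank_le (hφ : IsCutoff φ) {X : Type*} [TopologicalSpace X]
    [FirstCountableTopology X] {P : X → FredholmSpace φ H} (hP : Continuous P) (x₀ : X) {ε : ℝ}
    (hε : 0 < ε) [FiniteDimensional ℂ ((P x₀).1.spectralSubspace (-ε) ε)]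
    (hst : ∀ δ, 0 < δ → δ ≤ ε →
      (P x₀).1.spectralSubspace (-δ) δ = (P x₀).1.spectralSubspace (-ε) ε) :
    ∃ p : ℕ+, 1 / (p : ℝ) < ε ∧ ∀ᶠ x in 𝓝 x₀, ∀ W : Submodule ℂ H,
      W ≤ (P x).1.spectralSubspace (-(1 / (p : ℝ))) (1 / p) → FiniteDimensional ℂ W →
      Module.finrank ℂ W ≤ Module.finrank ℂ ((P x₀).1.spectralSubspace (-ε) ε) := by
  by_contra! hcon
  set r := Module.finrank ℂ ((P x₀).1.spectralSubspace (-ε) ε) with hr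
  obtain ⟨p₀', hp₀'⟩ := exists_nat_one_div_lt hε
  set p₀ : ℕ+ := p₀'.succPNat with hp₀
  have hp₀ε : 1 / (p₀ : ℝ) < ε := by simpa [hp₀] using hp₀'
  have hpos : ∀ p : ℕ+, 0 < 1 / (p : ℝ) := fun p => by
    have : (0 : ℝ) < p := by exact_mod_cast p.pos
    positivity
  -- The scales `1 / p k` tend to `0` and stay below `ε`; first countability yields offending points
  -- `x k → x₀`, one for each scale.
  set p : ℕ → ℕ+ := fun k => p₀ + k.succPNat with hp
  have hpk : ∀ k, 1 / (p k : ℝ) < ε := fun k =>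
    (pnat_one_div_anti (PNat.lt_add_right p₀ _).le).trans_lt hp₀ε
  obtain ⟨u, hu⟩ := (𝓝 x₀).exists_antitone_basis
  have hex : ∀ k, ∃ x ∈ u k, ∃ W : Submodule ℂ H,
      W ≤ (P x).1.spectralSubspace (-(1 / (p k : ℝ))) (1 / p k) ∧ FiniteDimensional ℂ W ∧
      r < Module.finrank ℂ W := fun k => by
    obtain ⟨x, hx, hx'⟩ := ((hcon (p k) (hpk k)).and_eventually (hu.mem k)).exists
    exact ⟨x, hx', hx⟩
  choose x hxu W hW hWf hWr using hex
  have hx : Tendsto x atTop (𝓝 x₀) := hu.tendsto hxu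
  have hne : ∀ k, P (x k) ≠ P x₀ := fun k h => by
    have h1 := hW k
    rw [h, hst _ (hpos _) (hpk k).le] at h1
    exact absurd (Submodule.finrank_mono h1) (not_le.2 (hWr k))
  -- In the inductive limit topology it suffices to treat each level: every `E` there needs a
  -- neighbourhood that avoids all `P (x k)`.
  have hopen : IsOpen (range fun k => P (x k))ᶜ := by
    rw [isOpen_fredholmSpace_iff]
    intro n
    rw [isOpen_iff_mem_nhds]
    intro E hE
    have hE' : ∀ k, FredholmLevel.incl φ n E ≠ P (x k) := fun k h => hE ⟨k, h.symm⟩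
    -- Finitely many `k` are harmless, because points are separated by their resolvents.
    obtain ⟨q, hq⟩ : ∃ q, ∀ᶠ E' in 𝓝 E, ∀ k ≥ q, FredholmLevel.incl φ n E' ≠ P (x k) := by
      by_cases h0 : FredholmLevel.incl φ n E = P x₀
      -- At `P x₀` itself: since `j > n`, `φ_j` is norm continuous on level `n`, whereas excess
      -- spectrum at scale `1 / (2 j)` keeps `φ_j(P (x k))` a fixed distance away. For `k ≥ 2 j` one
      -- has `p k ≥ 2 j`.
      · set j : ℕ+ := p₀ + n with hj
        have hjε : 1 / (j : ℝ) < ε :=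
          (pnat_one_div_anti (PNat.lt_add_right p₀ n).le).trans_lt hp₀ε
        have hst' := hst _ (hpos j) hjε.le
        have hVf : FiniteDimensional ℂ ((P x₀).1.spectralSubspace (-(1 / (j : ℝ))) (1 / j)) := by
          rw [hst']; infer_instance
        obtain ⟨c, hc, hcW⟩ := exists_le_norm_cutoffOp_sub hφ (P x₀).1 j
        refine ⟨2 * j, ?_⟩
        have hnj : n < j := PNat.lt_add_left n p₀
        have h1 := Metric.tendsto_nhds.1
          ((continuous_cutoffOp_of_lt (H := H) hφ hnj).tendsto E) c hc
        filter_upwards [h1] with E' hE'' k hk h2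
        have h3 : E.1 = (P x₀).1 := congrArg Subtype.val h0
        have h4 : E'.1 = (P (x k)).1 := congrArg Subtype.val h2
        rw [dist_eq_norm, h3, h4] at hE''
        refine absurd (hcW (P (x k)).1 (W k) ((hW k).trans ?_) (hWf k) ?_) (not_le.2 hE'')
        · have h5 : 1 / (p k : ℝ) ≤ 1 / (j : ℝ) / 2 := by
            rw [div_div]
            have hj0 : (0 : ℝ) < j := by exact_mod_cast j.pos
            refine one_div_le_one_div_of_le (by positivity) ?_
            have h6 : (j : ℕ) * 2 ≤ p k := by
              have : (p k : ℕ) = p₀ + (k + 1) := by simp [hp]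
              omega
            exact_mod_cast h6
          exact spectralSubspace_mono (neg_le_neg h5) h5
        · rw [hst']; exact hWr k
      -- Away from `P x₀`: the resolvents of `P (x k)` converge strongly to that of `P x₀`, which
      -- differs from that of `E` at some `v`.
      · obtain ⟨v, hv⟩ := exists_resolvent_ne h0
        obtain ⟨O₁, O₂, ho₁, ho₂, hm₁, hm₂, hd⟩ := t2_separation hv
        have hlim : Tendsto (fun k => (P (x k)).1.resolvent (-Complex.I) v) atTop
            (𝓝 ((P x₀).1.resolvent (-Complex.I) v)) :=
          (((stronglyContinuous_fredholmSpace (φ := φ)).comp hP).neg v).continuousAt.tendsto.comp hx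
        obtain ⟨q, hq⟩ := eventually_atTop.1 (hlim (ho₂.mem_nhds hm₂))
        refine ⟨q, ?_⟩
        filter_upwards [((stronglyContinuous_fredholmLevel (φ := φ) n).neg v).tendsto E
          (ho₁.mem_nhds hm₁)] with E' hE'' k hk h2
        have h4 : E'.1 = (P (x k)).1 := congrArg Subtype.val h2
        have h5 : E'.1.resolvent (-Complex.I) v ∈ O₁ := hE''
        rw [h4] at h5
        exact Set.disjoint_left.1 hd h5 (hq k hk)
    have hfin : ∀ᶠ E' in 𝓝 E, ∀ k ∈ Iio q, FredholmLevel.incl φ n E' ≠ P (x k) :=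
      ((finite_Iio q).eventually_all).2 fun k _ => eventually_incl_ne (hE' k)
    filter_upwards [hq, hfin] with E' h1 h2
    rintro ⟨k, hk⟩
    rcases lt_or_ge k q with h | h
    · exact h2 k h hk.symm
    · exact h1 k h hk.symm
  have hmem : P x₀ ∈ (range fun k => P (x k))ᶜ := fun ⟨k, hk⟩ => hne k hk
  obtain ⟨k, hk⟩ := (hx.eventually ((hopen.preimage hP).mem_nhds hmem)).exists
  exact hk ⟨k, rfl⟩

omit [CompleteSpace H] in
-- Bounding finite dimensional subspaces of `S`, and not `finrank` of `S`, is essential: `finrank`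
-- is `0` in infinite dimension.
theorem finite_and_finrank_le {S : Submodule ℂ H} {r : ℕ}
    (h : ∀ W ≤ S, FiniteDimensional ℂ W → Module.finrank ℂ W ≤ r) :
    FiniteDimensional ℂ S ∧ Module.finrank ℂ S ≤ r := by
  have h1 : Module.rank ℂ S ≤ r := by
    refine rank_le fun s hs => ?_
    have h2 := h ((Submodule.span ℂ (s : Set S)).map S.subtype) (Submodule.map_subtype_le _ _)
      inferInstance
    rw [← (Submodule.equivMapOfInjective S.subtype S.subtype_injective _).finrank_eq] at h2
    rwa [finrank_span_finset_eq_card hs] at h2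
  have h2 : FiniteDimensional ℂ S :=
    Module.rank_lt_aleph0_iff.1 (h1.trans_lt (Cardinal.natCast_lt_aleph0))
  exact ⟨h2, by rw [← Module.finrank_eq_rank] at h1; exact_mod_cast h1⟩

/-- Near every point a continuous family is continuous at some level, and some `μ > 0` is in the
range where the spectral flow can be read off directly. -/
theorem exists_local_level (hφ : IsCutoff φ) {X : Type*} [TopologicalSpace X]
    [FirstCountableTopology X] {P : X → FredholmSpace φ H} (hP : Continuous P) (x₀ : X) :
    ∃ (n : ℕ+) (μ : ℝ) (U : Set X), U ∈ 𝓝 x₀ ∧ 0 < μ ∧ μ < 1 / (n : ℝ) ∧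
      (∃ E : U → FredholmLevel φ n H, Continuous E ∧ ∀ x : U, FredholmLevel.incl φ n (E x) = P x) ∧
      ∀ x ∈ U, (P x).1.InResolventSet (μ : ℂ) ∧ (P x).1.InResolventSet (-(μ : ℂ)) ∧
        FiniteDimensional ℂ ((P x).1.spectralSubspace (-μ) μ) := by
  obtain ⟨ε₀, hε₀, hVf, hst⟩ := IsFredholm.exists_stable (P x₀).2
  obtain ⟨p, hpε, hev⟩ := exists_eventually_finrank_le hφ hP x₀ hε₀ hst
  set r := Module.finrank ℂ ((P x₀).1.spectralSubspace (-ε₀) ε₀) with hr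
  have hp0 : (0 : ℝ) < p := by exact_mod_cast p.pos
  set ε := 1 / (p : ℝ) with hε
  have hε0 : 0 < ε := by positivity
  have hPs : StronglyContinuous fun x => (P x).1 := stronglyContinuous_fredholmSpace.comp hP
  have hε4 : 0 < ε / 4 := by positivity
  have hε2 : 0 < ε / 2 := by positivity
  set f₀ := trapezoid (-(ε / 4)) (ε / 4) (ε / 4) with hf₀
  have hf₀C : IsC0 f₀ := isC0_trapezoid _ _ hε4
  have hf₀0 : ∀ t, t ∉ Icc (-(ε / 2)) (ε / 2) → f₀ t = 0 := fun t ht =>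
    trapezoid_eq_zero_of_notMem hε4 fun h => ht ⟨by linarith [h.1], by linarith [h.2]⟩
  have hf₀1 : ∀ D : SelfAdjointOp H, ‖D.funcCalc f₀‖ ≤ 1 := fun D =>
    D.norm_funcCalc_le zero_le_one fun t => by
      rw [abs_of_nonneg (trapezoid_nonneg _ _ _ _)]; exact trapezoid_le_one _ _ _ hε4
  have hclose := eventually_norm_sub_le (fun x => hf₀1 (P x).1) (hf₀1 (P x₀).1)
    (fun v => (hPs.continuous_funcCalc hf₀C v).tendsto x₀)
    ((P x₀).1.spectralSubspace (-ε₀) ε₀) (ε := 1 / 2) (by norm_num)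
  -- On `U` the dimension is exactly `r` and nothing is gained between `ε / 2` and `ε`; this
  -- supplies the gap and the constant rank.
  set U : Set X := {x | (FiniteDimensional ℂ ((P x).1.spectralSubspace (-ε) ε) ∧
    (P x).1.spectralSubspace (-(ε / 2)) (ε / 2) = (P x).1.spectralSubspace (-ε) ε) ∧
    Module.finrank ℂ ((P x).1.spectralSubspace (-ε) ε) = r} with hU
  have hUmem : U ∈ 𝓝 x₀ := by
    filter_upwards [hev, hclose] with x h1 h2
    obtain ⟨hfin, hle⟩ := finite_and_finrank_le h1
    have hmono : (P x).1.spectralSubspace (-(ε / 2)) (ε / 2) ≤ (P x).1.spectralSubspace (-ε) ε :=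
      spectralSubspace_mono (by linarith) (by linarith)
    have hfin2 : FiniteDimensional ℂ ((P x).1.spectralSubspace (-(ε / 2)) (ε / 2)) :=
      Submodule.finiteDimensional_of_le hmono
    -- `f₀(P x₀)` is the identity on the kernel-scale subspace of `P x₀`, so for `x` near `x₀` the
    -- operator `f₀(P x)` is injective there, with values at scale `ε / 2`.
    have hge : r ≤ Module.finrank ℂ ((P x).1.spectralSubspace (-(ε / 2)) (ε / 2)) := by
      refine finrank_le_of_injOn ((P x).1.funcCalc f₀)
        (fun v _ => funcCalc_mem_spectralSubspace hf₀C hf₀0 v) fun v hv h0 => ?_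
      have h3 := h2 v hv
      rw [← hst (ε / 4) hε4 (by linarith)] at hv
      rw [funcCalc_eq_self_of_mem hv hf₀C fun t ht => trapezoid_eq_one _ ht] at h3
      exact eq_zero_of_norm_le (by norm_num) h3 h0
    have heq := Submodule.eq_of_le_of_finrank_le hmono (hle.trans hge)
    exact ⟨⟨hfin, heq⟩, le_antisymm hle (heq ▸ hge)⟩
  -- The windows of radius `ε / 8` about `±3ε / 4` lie in `[-ε, ε]` and miss `[-ε / 2, ε / 2]`,
  -- while both intervals have the same spectral subspace.
  have hgap : ∀ x ∈ U, ∀ s, s = 1 ∨ s = -1 →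
      (P x).1.InResolventSet ((s * (3 / 4 * ε) : ℝ) : ℂ) := by
    rintro x ⟨⟨-, hx⟩, -⟩ s hs
    refine inResolventSet_of_gap (η := ε / 8) (by positivity) ?_
    rw [eq_bot_iff]
    rcases hs with rfl | rfl
    · rw [← spectralSubspace_inf_eq_bot (D := (P x).1) (α := -(ε / 2)) (β := ε / 2)
        (γ := 1 * (3 / 4 * ε) - ε / 8) (δ := 1 * (3 / 4 * ε) + ε / 8) (by linarith)]
      refine le_inf ?_ le_rfl
      rw [hx]
      exact spectralSubspace_mono (by linarith) (by linarith)
    · rw [← spectralSubspace_inf_eq_bot (D := (P x).1) (γ := -(ε / 2)) (δ := ε / 2)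
        (α := -1 * (3 / 4 * ε) - ε / 8) (β := -1 * (3 / 4 * ε) + ε / 8) (by linarith)]
      refine le_inf le_rfl ?_
      rw [hx]
      exact spectralSubspace_mono (by linarith) (by linarith)
  have hφmem : ∀ x v, (P x).1.cutoffOp φ p v ∈ (P x).1.spectralSubspace (-ε) ε := fun x v =>
    funcCalc_mem_spectralSubspace (hφ.isC0_scaled p) (fun t => hφ.scaled_eq_zero_of_notMem p) v
  have hcomp : ∀ x ∈ U, IsCompactOperator ((P x).1.cutoffOp φ p) := by
    rintro x ⟨⟨hx, -⟩, -⟩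
    exact isCompactOperator_of_mem _ (hφmem x)
  have hUs : StronglyContinuous fun x : U => (P x).1 := hPs.comp continuous_subtype_val
  -- Thanks to the gap, `h(P x)` is the projection of rank `r` onto the spectral subspace of `[-ε,
  -- ε]`, hence norm continuous on `U`.
  set h := trapezoid (-(ε / 2)) (ε / 2) (ε / 2) with hh
  have hhC : IsC0 h := isC0_trapezoid _ _ hε2
  have hh0 : ∀ t, t ∉ Icc (-ε) ε → h t = 0 := fun t ht =>
    trapezoid_eq_zero_of_notMem hε2 fun h => ht ⟨by linarith [h.1], by linarith [h.2]⟩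
  have hfix : ∀ x : U, ∀ v ∈ (P x).1.spectralSubspace (-ε) ε, (P x).1.funcCalc h v = v := by
    intro x v hv
    rw [← x.2.1.2] at hv
    exact funcCalc_eq_self_of_mem hv hhC fun t ht => trapezoid_eq_one _ ht
  have hmem : ∀ x v, (P x).1.funcCalc h v ∈ (P x).1.spectralSubspace (-ε) ε := fun x v =>
    funcCalc_mem_spectralSubspace hhC hh0 v
  have hrange : ∀ x : U, LinearMap.range ((P x).1.funcCalc h : H →ₗ[ℂ] H) =
      (P x).1.spectralSubspace (-ε) ε := fun x => by
    refine le_antisymm ?_ fun v hv => ⟨v, hfix x v hv⟩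
    rintro _ ⟨v, rfl⟩
    exact hmem x v
  have hh1 : ∀ D : SelfAdjointOp H, ‖D.funcCalc h‖ ≤ 1 := fun D =>
    D.norm_funcCalc_le zero_le_one fun t => by
      rw [abs_of_nonneg (trapezoid_nonneg _ _ _ _)]; exact trapezoid_le_one _ _ _ hε2
  have hQ : Continuous fun x : U => (P x).1.funcCalc h :=
    continuous_of_finrank_eq (r := r)
      (fun x => ContinuousLinearMap.ext fun v => hfix x _ (hmem x v))
      (fun x => star_funcCalc _ _) (fun x => hh1 _)
      (fun x => by rw [hrange]; exact x.2.1.1) (fun x => by rw [hrange]; exact x.2.2)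
      fun v => hUs.continuous_funcCalc hhC v
  have hcont : Continuous fun x : U => (P x).1.cutoffOp φ p := by
    obtain ⟨C, hC0, hC⟩ := (hφ.isC0_scaled p).exists_bound
    -- A strongly continuous factor times a norm continuous compact one is norm continuous.
    have hprod : ∀ x : U, (P x).1.cutoffOp φ p =
        (P x).1.cutoffOp φ p * (P x).1.funcCalc h := fun x => by
      have h1 : (P x).1.funcCalc h * (P x).1.cutoffOp φ p = (P x).1.cutoffOp φ p :=
        ContinuousLinearMap.ext fun v => hfix x _ (hφmem x v)
      have h2 := congrArg star h1
      rw [star_mul, cutoffOp, star_funcCalc, star_funcCalc] at h2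
      exact h2.symm
    refine continuous_iff_continuousAt.2 fun x₁ => ?_
    have h3 := tendsto_mul_of_isCompactOperator (C := C)
      (fun x : U => (P x).1.norm_funcCalc_le hC0 hC) ((P x₁).1.norm_funcCalc_le hC0 hC)
      (fun v => (hUs.continuous_funcCalc (hφ.isC0_scaled p) v).tendsto x₁) (hQ.tendsto x₁)
      (by
        have := x₁.2.1.1
        exact isCompactOperator_of_mem _ (hmem x₁))
    rw [ContinuousAt, hprod x₁]
    exact h3.congr fun x => (hprod x).symm
  refine ⟨p, 3 / 4 * ε, U, hUmem, by positivity, by linarith, ?_, fun x hx => ⟨?_, ?_, ?_⟩⟩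
  · exact ⟨fun x => ⟨(P x).1, (P x).2, hcomp x x.2⟩,
      continuous_fredholmLevel_iff.2 ⟨hUs, hcont⟩, fun x => rfl⟩
  · have := hgap x hx 1 (Or.inl rfl)
    rwa [one_mul] at this
  · have := hgap x hx (-1) (Or.inr rfl)
    rwa [neg_one_mul, Complex.ofReal_neg] at this
  · have := hx.1.1
    have hle : (P x).1.spectralSubspace (-(3 / 4 * ε)) (3 / 4 * ε) ≤
        (P x).1.spectralSubspace (-ε) ε := spectralSubspace_mono (by linarith) (by linarith)
    exact Submodule.finiteDimensional_of_le hle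

/-! ### Intervals on which the spectral flow can be read off directly -/

variable {P Q : ℝ → FredholmSpace φ H}

theorem ContinuousInLevel.mono {n : ℕ+} {I J : Set ℝ} (h : ContinuousInLevel n P I) (hJ : J ⊆ I) :
    ContinuousInLevel n P J := by
  obtain ⟨E, hE, hE'⟩ := h
  exact ⟨fun t => E (inclusion hJ t), hE.comp (continuous_inclusion hJ), fun t => hE' _⟩

theorem ContinuousInLevel.congr {n : ℕ+} {I : Set ℝ} (h : ContinuousInLevel n P I)
    (hQ : EqOn P Q I) : ContinuousInLevel n Q I := by
  obtain ⟨E, hE, hE'⟩ := h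
  exact ⟨E, hE, fun t => (hE' t).trans (hQ t.2)⟩

theorem IsAdmissible.mono {u v u' v' μ : ℝ} (h : IsAdmissible P u v μ) (hu : u ≤ u')
    (hv : v' ≤ v) : IsAdmissible P u' v' μ := by
  obtain ⟨h0, ⟨n, hn, hc⟩, h1⟩ := h
  have hs : Icc u' v' ⊆ Icc u v := Icc_subset_Icc hu hv
  exact ⟨h0, ⟨n, hn, hc.mono hs⟩, fun t ht => h1 t (hs ht)⟩

theorem IsAdmissible.congr {u v μ : ℝ} (h : IsAdmissible P u v μ) (hQ : EqOn P Q (Icc u v)) :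
    IsAdmissible Q u v μ := by
  obtain ⟨h0, ⟨n, hn, hc⟩, h1⟩ := h
  exact ⟨h0, ⟨n, hn, hc.congr hQ⟩, fun t ht => by rw [← hQ ht]; exact h1 t ht⟩

theorem ContinuousInLevel.finrank_eq (hφ : IsCutoff φ) {n : ℕ+} {u v : ℝ} (huv : u ≤ v)
    (h : ContinuousInLevel n P (Icc u v)) {α β : ℝ} (hα : -(1 / (n : ℝ)) < α) (hαβ : α < β)
    (hβ : β < 1 / (n : ℝ))
    (h1 : ∀ t ∈ Icc u v, (P t).1.InResolventSet (α : ℂ) ∧ (P t).1.InResolventSet (β : ℂ) ∧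
      FiniteDimensional ℂ ((P t).1.spectralSubspace α β)) :
    Module.finrank ℂ ((P u).1.spectralSubspace α β) =
      Module.finrank ℂ ((P v).1.spectralSubspace α β) := by
  obtain ⟨E, hE, hE'⟩ := h
  have hE1 : ∀ t, (E t).1 = (P t).1 := fun t => congrArg Subtype.val (hE' t)
  obtain ⟨hs, hc⟩ := continuous_fredholmLevel_iff.1 hE
  have : PreconnectedSpace (Icc u v) := isPreconnected_iff_preconnectedSpace.1 isPreconnected_Icc
  obtain ⟨c, hc1, hc2⟩ := exists_between (max_lt (neg_lt.1 hα) hβ)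
  obtain ⟨hcα, hcβ⟩ := max_lt_iff.1 hc1
  have key := finrank_eq_of_preconnected (D := fun t => (E t).1) (c := c)
    (fun f hf hf0 => continuous_funcCalc_of_cutoffOp hs hφ hc (fun t => (E t).2.2)
      (by linarith) hc2 hf hf0) (α := α) (β := β) (by linarith) hαβ hcβ
    (fun t => by rw [hE1]; exact (h1 t t.2).1) (fun t => by rw [hE1]; exact (h1 t t.2).2.1)
    (fun t => by rw [hE1]; exact (h1 t t.2).2.2)
    ⟨u, left_mem_Icc.2 huv⟩ ⟨v, right_mem_Icc.2 huv⟩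
  rwa [hE1, hE1] at key

/-- Passing from `μ` to `μ'` adds the rank of `1_[μ, μ']` at both ends, and this rank is constant on
`[u, v]`. The level attached to the larger `μ'` is the one that covers `[μ, μ']`. -/
theorem contribution_eq_of_lt (hφ : IsCutoff φ) {u v μ μ' : ℝ} (huv : u ≤ v)
    (h : IsAdmissible P u v μ) (h' : IsAdmissible P u v μ') (hlt : μ < μ') :
    contribution P u v μ = contribution P u v μ' := by
  obtain ⟨hμ0, -, h1⟩ := h
  obtain ⟨hμ'0, ⟨n, hn, hc⟩, h2⟩ := h'
  have hfin : ∀ t ∈ Icc u v, ∀ α β, -μ' ≤ α → β ≤ μ' →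
      FiniteDimensional ℂ ((P t).1.spectralSubspace α β) := fun t ht α β hα hβ => by
    have := (h2 t ht).2.2
    exact Submodule.finiteDimensional_of_le (SelfAdjointOp.spectralSubspace_mono hα hβ)
  have hadd : ∀ t ∈ Icc u v, Module.finrank ℂ ((P t).1.spectralSubspace 0 μ') =
      Module.finrank ℂ ((P t).1.spectralSubspace 0 μ) +
        Module.finrank ℂ ((P t).1.spectralSubspace μ μ') := fun t ht => by
    have := hfin t ht 0 μ' (by linarith) le_rfl
    exact SelfAdjointOp.finrank_spectralSubspace_add hμ0.le hlt.le (h1 t ht).1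
  have hconst := hc.finrank_eq hφ huv (α := μ) (β := μ') (by linarith) hlt hn fun t ht =>
    ⟨(h1 t ht).1, (h2 t ht).1, hfin t ht μ μ' (by linarith) le_rfl⟩
  rw [contribution, contribution, hadd u (left_mem_Icc.2 huv), hadd v (right_mem_Icc.2 huv), hconst]
  push_cast
  ring

theorem contribution_eq (hφ : IsCutoff φ) {u v μ μ' : ℝ} (huv : u ≤ v)
    (h : IsAdmissible P u v μ) (h' : IsAdmissible P u v μ') :
    contribution P u v μ = contribution P u v μ' := by
  rcases lt_trichotomy μ μ' with hlt | rfl | hlt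
  · exact contribution_eq_of_lt hφ huv h h' hlt
  · rfl
  · exact (contribution_eq_of_lt hφ huv h' h hlt).symm

theorem contribution_eq_zero (hφ : IsCutoff φ) {u v μ : ℝ} (huv : u ≤ v)
    (h : IsAdmissible P u v μ) (hinv : ∀ t ∈ Icc u v, (P t).1.IsInvertible) :
    contribution P u v μ = 0 := by
  obtain ⟨hμ0, ⟨n, hn, hc⟩, h1⟩ := h
  have := hc.finrank_eq hφ huv (α := 0) (β := μ) (by linarith) hμ0 hn fun t ht =>
    ⟨by rw [Complex.ofReal_zero]; exact hinv t ht, (h1 t ht).1, by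
      have := (h1 t ht).2.2
      exact Submodule.finiteDimensional_of_le (SelfAdjointOp.spectralSubspace_mono
        (D := (P t).1) (α := 0) (α' := -μ) (by linarith) le_rfl)⟩
  rw [contribution, this, sub_self]

/-- Stated for curves `γ` in a parameter space, so that one `μ` serves both a path and all
horizontal and vertical segments of a small rectangle. -/
theorem exists_local_admissible (hφ : IsCutoff φ) {Y : Type*} [PseudoMetricSpace Y]
    {D : Y → FredholmSpace φ H} {K : Set Y} (hD : ContinuousOn D K) {z : Y} (hz : z ∈ K) :
    ∃ δ > 0, ∃ μ, ∀ (γ : ℝ → Y) (u v : ℝ), Continuous γ →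
      MapsTo γ (Icc u v) (K ∩ Metric.ball z δ) → IsAdmissible (fun t => D (γ t)) u v μ := by
  obtain ⟨n, μ, U, hU, hμ0, hμn, ⟨E, hE, hE'⟩, h⟩ :=
    exists_local_level hφ (continuousOn_iff_continuous_domRestrict.1 hD) ⟨z, hz⟩
  obtain ⟨V, hV, hVU⟩ := mem_nhds_subtype K ⟨z, hz⟩ U |>.1 hU
  obtain ⟨δ, hδ, hδV⟩ := Metric.mem_nhds_iff.1 hV
  refine ⟨δ, hδ, μ, fun γ u v hγ hmaps => ?_⟩
  have hmem : ∀ t ∈ Icc u v, ∃ hK : γ t ∈ K, (⟨γ t, hK⟩ : K) ∈ U := fun t ht =>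
    ⟨(hmaps ht).1, hVU (hδV (hmaps ht).2)⟩
  refine ⟨hμ0, ⟨n, hμn, fun t => E ⟨⟨γ t, (hmem t t.2).1⟩, (hmem t t.2).2⟩, ?_, ?_⟩, ?_⟩
  · exact hE.comp (Continuous.subtype_mk (Continuous.subtype_mk
      (hγ.comp continuous_subtype_val) _) _)
  · exact fun t => hE' _
  · intro t ht
    obtain ⟨hK, hU'⟩ := hmem t ht
    exact h _ hU'

/-! ### Spectral flow -/

/-- Compactness of `[a, b]`: a fine enough subdivision has each piece inside one of the balls, and
the pieces are glued from left to right. -/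
theorem interval_induction {R : ℝ → ℝ → Prop} {a b : ℝ} (hab : a ≤ b)
    (hglue : ∀ u c v, a ≤ u → u ≤ c → c ≤ v → v ≤ b → R u c → R c v → R u v)
    (hloc : ∀ x ∈ Icc a b, ∃ δ > 0, ∀ u v, a ≤ u → u ≤ v → v ≤ b → |u - x| < δ → |v - x| < δ →
      R u v) : R a b := by
  choose! δ hδ hR using hloc
  obtain ⟨t, ht0, htm, ⟨m, hm⟩, ht⟩ := exists_monotone_Icc_subset_open_cover_Icc hab
    (c := fun x : Icc a b => Metric.ball x (δ x)) (fun x => Metric.isOpen_ball)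
    fun x _ => mem_iUnion.2 ⟨x, Metric.mem_ball_self (hδ x x.2)⟩
  have key : ∀ n, R a (t n) := by
    intro n
    induction n with
    | zero =>
      rw [ht0]
      exact hR a (left_mem_Icc.2 hab) a a le_rfl le_rfl hab (by simpa using hδ a (left_mem_Icc.2 hab))
        (by simpa using hδ a (left_mem_Icc.2 hab))
    | succ n ih =>
      obtain ⟨x, hx⟩ := ht n
      have hle : t n ≤ t (n + 1) := htm n.le_succ
      refine hglue a (t n) (t (n + 1)) le_rfl (t n).2.1 hle (t (n + 1)).2.2 ih ?_
      exact hR x x.2 _ _ (t n).2.1 hle (t (n + 1)).2.2 (hx (left_mem_Icc.2 hle))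
        (hx (right_mem_Icc.2 hle))
  have := key m
  rwa [hm m le_rfl] at this

theorem le_of_chain {τ : ℕ → ℝ} {k : ℕ} (h : ∀ i < k, τ i ≤ τ (i + 1)) {i j : ℕ} (hij : i ≤ j)
    (hj : j ≤ k) : τ i ≤ τ j := by
  induction j, hij using Nat.le_induction with
  | base => exact le_rfl
  | succ j _ ih => exact (ih (by omega)).trans (h j (by omega))

theorem IsAdmissible.isSpectralFlow {u v μ : ℝ} (huv : u ≤ v) (h : IsAdmissible P u v μ) :
    IsSpectralFlow P u v (contribution P u v μ) :=
  ⟨1, fun i => if i = 0 then u else v, fun _ => μ, by simp, by simp, by simp [huv, h], by simp⟩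

theorem IsSpectralFlow.trans {u v w : ℝ} {N M : ℤ} (hN : IsSpectralFlow P u v N)
    (hM : IsSpectralFlow P v w M) : IsSpectralFlow P u w (N + M) := by
  obtain ⟨k, τ, μ, h0, hk, h, rfl⟩ := hN
  obtain ⟨k', τ', μ', h0', hk', h', rfl⟩ := hM
  set T : ℕ → ℝ := fun i => if i < k then τ i else τ' (i - k) with hT
  set M : ℕ → ℝ := fun i => if i < k then μ i else μ' (i - k) with hM
  have hT1 : ∀ i ≤ k, T i = τ i := fun i hi => by
    rcases hi.lt_or_eq with h1 | rfl
    · simp [hT, h1]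
    · simp [hT, h0', hk]
  have hT2 : ∀ i, T (k + i) = τ' i := fun i => by simp [hT]
  have hM1 : ∀ i < k, M i = μ i := fun i hi => by simp [hM, hi]
  have hM2 : ∀ i, M (k + i) = μ' i := fun i => by simp [hM]
  refine ⟨k + k', T, M, by rw [hT1 0 k.zero_le, h0], by rw [hT2, hk'], fun i hi => ?_, ?_⟩
  · rcases lt_or_ge i k with h1 | h1
    · rw [hT1 i h1.le, hT1 (i + 1) h1, hM1 i h1]
      exact h i h1
    · obtain ⟨j, rfl⟩ := Nat.exists_eq_add_of_le h1
      rw [hT2, add_assoc, hT2, hM2]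
      exact h' j (by omega)
  · rw [Finset.sum_range_add]
    congr 1
    · refine Finset.sum_congr rfl fun i hi => ?_
      have h1 := Finset.mem_range.1 hi
      rw [hT1 i h1.le, hT1 (i + 1) h1, hM1 i h1]
    · refine Finset.sum_congr rfl fun i _ => ?_
      rw [hT2, add_assoc, hT2, hM2]

theorem IsSpectralFlow.congr {a b : ℝ} {N : ℤ} (h : IsSpectralFlow P a b N)
    (hQ : EqOn P Q (Icc a b)) : IsSpectralFlow Q a b N := by
  obtain ⟨k, τ, μ, rfl, rfl, h, rfl⟩ := h
  have hmem : ∀ i ≤ k, τ i ∈ Icc (τ 0) (τ k) := fun i hi =>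
    ⟨le_of_chain (fun i hi => (h i hi).1) i.zero_le hi, le_of_chain (fun i hi => (h i hi).1) hi le_rfl⟩
  refine ⟨k, τ, μ, rfl, rfl, fun i hi => ⟨(h i hi).1, (h i hi).2.congr (hQ.mono ?_)⟩, ?_⟩
  · exact Icc_subset_Icc (hmem i hi.le).1 (hmem (i + 1) hi).2
  · refine Finset.sum_congr rfl fun i hi => ?_
    have h1 := Finset.mem_range.1 hi
    rw [contribution, contribution, hQ (hmem i h1.le), hQ (hmem (i + 1) h1)]

/-- `σ` is a potential for the contributions of the subintervals of `[a, b]`. -/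
def IsPotential (P : ℝ → FredholmSpace φ H) (a b : ℝ) (σ : ℝ → ℤ) : Prop :=
  ∀ u v μ, a ≤ u → u ≤ v → v ≤ b → IsAdmissible P u v μ → contribution P u v μ = σ v - σ u

theorem contribution_add (P : ℝ → FredholmSpace φ H) (u v w μ : ℝ) :
    contribution P u w μ = contribution P u v μ + contribution P v w μ := by
  simp only [contribution]; ring

/-- Both potentials are normalized to vanish at `c`; an interval containing `c` is cut there with
the same `μ`. Potentials make common refinements of subdivisions unnecessary. -/
theorem IsPotential.glue {a c b : ℝ} {σ τ : ℝ → ℤ} (h : IsPotential P a c σ)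
    (h' : IsPotential P c b τ) : ∃ ρ, IsPotential P a b ρ := by
  refine ⟨fun t => if t ≤ c then σ t - σ c else τ t - τ c, fun u v μ hu huv hv hadm => ?_⟩
  dsimp only
  rcases le_or_gt v c with hvc | hvc
  · rw [h u v μ hu huv hvc hadm, if_pos hvc, if_pos (huv.trans hvc)]; ring
  · rw [if_neg (not_le.2 hvc)]
    rcases le_or_gt u c with huc | huc
    · rw [contribution_add P u c v, h u c μ hu huc le_rfl (hadm.mono le_rfl hvc.le),
        h' c v μ le_rfl hvc.le hv (hadm.mono huc le_rfl), if_pos huc]; ring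
    · rw [h' u v μ huc.le huv hv hadm, if_neg (not_le.2 huc)]; ring

theorem IsPotential.eq_sub {a b : ℝ} {σ : ℝ → ℤ} (hσ : IsPotential P a b σ) {N : ℤ}
    (h : IsSpectralFlow P a b N) : N = σ b - σ a := by
  obtain ⟨k, τ, μ, rfl, rfl, h, rfl⟩ := h
  rw [← Finset.sum_range_sub (fun i => σ (τ i))]
  refine Finset.sum_congr rfl fun i hi => ?_
  have h1 := Finset.mem_range.1 hi
  exact hσ _ _ _ (le_of_chain (fun i hi => (h i hi).1) i.zero_le h1.le) (h i h1).1
    (le_of_chain (fun i hi => (h i hi).1) h1 le_rfl) (h i h1).2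

/-- Existence of a value and of a potential are both local and can be glued; uniqueness follows
since sums telescope against the potential. Locally the potential is `dim Ran 1_[0, μ](P t)` for the
common `μ`. -/
theorem existsUnique_isSpectralFlow (hφ : IsCutoff φ) {a b : ℝ} (hab : a ≤ b)
    (hP : ContinuousOn P (Icc a b)) : ∃! N : ℤ, IsSpectralFlow P a b N := by
  have key : (∃ N, IsSpectralFlow P a b N) ∧ ∃ σ, IsPotential P a b σ := by
    refine interval_induction hab
      (R := fun u v => (∃ N, IsSpectralFlow P u v N) ∧ ∃ σ, IsPotential P u v σ) ?_ ?_
    · rintro u c v - - - - ⟨⟨N, hN⟩, ⟨σ, hσ⟩⟩ ⟨⟨M, hM⟩, ⟨τ, hτ⟩⟩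
      exact ⟨⟨_, hN.trans hM⟩, hσ.glue hτ⟩
    · intro x hx
      obtain ⟨δ, hδ, μ, h⟩ := exists_local_admissible hφ hP hx
      refine ⟨δ, hδ, fun u v hu huv hv hux hvx => ?_⟩
      have hadm : IsAdmissible P u v μ := by
        refine h id u v continuous_id fun t ht => ⟨⟨hu.trans ht.1, ht.2.trans hv⟩, ?_⟩
        rw [abs_lt] at hux hvx
        rw [Metric.mem_ball, Real.dist_eq, abs_lt]
        exact ⟨by linarith [ht.1, hux.1, id_eq t], by linarith [ht.2, hvx.2, id_eq t]⟩
      refine ⟨⟨_, hadm.isSpectralFlow huv⟩,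
        fun t => Module.finrank ℂ ((P t).1.spectralSubspace 0 μ), fun u' v' μ' h1 h2 h3 h4 => ?_⟩
      exact contribution_eq hφ h2 h4 (hadm.mono h1 h3)
  obtain ⟨⟨N, hN⟩, ⟨σ, hσ⟩⟩ := key
  exact ⟨N, hN, fun M hM => (hσ.eq_sub hM).trans (hσ.eq_sub hN).symm⟩

theorem isSpectralFlow_spfl (hφ : IsCutoff φ) {a b : ℝ} (hab : a ≤ b)
    (hP : ContinuousOn P (Icc a b)) : IsSpectralFlow P a b (spfl P a b) := by
  have h := (existsUnique_isSpectralFlow hφ hab hP).exists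
  rw [spfl, dif_pos h]
  exact h.choose_spec

theorem spfl_eq (hφ : IsCutoff φ) {a b : ℝ} (hab : a ≤ b) (hP : ContinuousOn P (Icc a b)) {N : ℤ}
    (h : IsSpectralFlow P a b N) : spfl P a b = N :=
  (existsUnique_isSpectralFlow hφ hab hP).unique (isSpectralFlow_spfl hφ hab hP) h

theorem spfl_add (hφ : IsCutoff φ) {u v w : ℝ} (huv : u ≤ v) (hvw : v ≤ w)
    (hP : ContinuousOn P (Icc u w)) : spfl P u w = spfl P u v + spfl P v w :=
  spfl_eq hφ (huv.trans hvw) hP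
    ((isSpectralFlow_spfl hφ huv (hP.mono (Icc_subset_Icc le_rfl hvw))).trans
      (isSpectralFlow_spfl hφ hvw (hP.mono (Icc_subset_Icc huv le_rfl))))

theorem spfl_congr (hφ : IsCutoff φ) {a b : ℝ} (hab : a ≤ b) (hP : ContinuousOn P (Icc a b))
    (hQ : EqOn P Q (Icc a b)) : spfl P a b = spfl Q a b :=
  (spfl_eq hφ hab (hP.congr hQ.symm) ((isSpectralFlow_spfl hφ hab hP).congr hQ)).symm

theorem spfl_eq_zero (hφ : IsCutoff φ) {a b : ℝ} (hab : a ≤ b) (hP : ContinuousOn P (Icc a b))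
    (hinv : ∀ t ∈ Icc a b, (P t).1.IsInvertible) : spfl P a b = 0 := by
  obtain ⟨k, τ, μ, h0, hk, h, hN⟩ := isSpectralFlow_spfl hφ hab hP
  rw [hN]
  refine Finset.sum_eq_zero fun i hi => ?_
  have h1 := Finset.mem_range.1 hi
  refine contribution_eq_zero hφ (h i h1).1 (h i h1).2 fun t ht => hinv t ⟨?_, ?_⟩
  · rw [← h0]
    exact (le_of_chain (fun i hi => (h i hi).1) i.zero_le h1.le).trans ht.1
  · rw [← hk]
    exact ht.2.trans (le_of_chain (fun i hi => (h i hi).1) h1 le_rfl)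

/-! ### Rectangles -/

/-- The sum of the spectral flows around the boundary of `[s₀, s₁] × [t₀, t₁]`. -/
def boundaryFlow (D : ℝ × ℝ → FredholmSpace φ H) (s₀ s₁ t₀ t₁ : ℝ) : ℤ :=
  spfl (fun t => D (s₀, t)) t₀ t₁ + spfl (fun s => D (s, t₁)) s₀ s₁ -
    spfl (fun t => D (s₁, t)) t₀ t₁ - spfl (fun s => D (s, t₀)) s₀ s₁

variable {D : ℝ × ℝ → FredholmSpace φ H} {a b c d : ℝ}

theorem continuousOn_right (hD : ContinuousOn D (Icc c d ×ˢ Icc a b)) {s : ℝ} (hs : s ∈ Icc c d) :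
    ContinuousOn (fun t => D (s, t)) (Icc a b) :=
  hD.comp (by fun_prop) fun _ ht => ⟨hs, ht⟩

theorem continuousOn_left (hD : ContinuousOn D (Icc c d ×ˢ Icc a b)) {t : ℝ} (ht : t ∈ Icc a b) :
    ContinuousOn (fun s => D (s, t)) (Icc c d) :=
  hD.comp (by fun_prop) fun _ hs => ⟨hs, ht⟩

/-- With one `μ` for the whole small rectangle, each side contributes a difference of values of `dim
Ran 1_[0, μ]` at its corners, and these cancel around the boundary. -/
theorem exists_boundaryFlow_eq_zero (hφ : IsCutoff φ) (hD : ContinuousOn D (Icc c d ×ˢ Icc a b))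
    {s t : ℝ} (hs : s ∈ Icc c d) (ht : t ∈ Icc a b) :
    ∃ δ > 0, ∀ s₀ s₁ t₀ t₁, c ≤ s₀ → s₀ ≤ s₁ → s₁ ≤ d → a ≤ t₀ → t₀ ≤ t₁ → t₁ ≤ b →
      |s₀ - s| < δ → |s₁ - s| < δ → |t₀ - t| < δ → |t₁ - t| < δ →
      boundaryFlow D s₀ s₁ t₀ t₁ = 0 := by
  obtain ⟨δ, hδ, μ, h⟩ := exists_local_admissible hφ hD (z := (s, t)) ⟨hs, ht⟩
  refine ⟨δ, hδ, fun s₀ s₁ t₀ t₁ hs₀ hs₀₁ hs₁ ht₀ ht₀₁ ht₁ ds₀ ds₁ dt₀ dt₁ => ?_⟩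
  have hmem : ∀ x ∈ Icc s₀ s₁, ∀ y ∈ Icc t₀ t₁,
      (x, y) ∈ Icc c d ×ˢ Icc a b ∩ Metric.ball (s, t) δ := by
    intro x hx y hy
    refine ⟨⟨⟨hs₀.trans hx.1, hx.2.trans hs₁⟩, ⟨ht₀.trans hy.1, hy.2.trans ht₁⟩⟩, ?_⟩
    rw [abs_lt] at ds₀ ds₁ dt₀ dt₁
    rw [Metric.mem_ball, Prod.dist_eq, max_lt_iff, Real.dist_eq, Real.dist_eq, abs_lt, abs_lt]
    exact ⟨⟨by linarith [hx.1], by linarith [hx.2]⟩, ⟨by linarith [hy.1], by linarith [hy.2]⟩⟩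
  have hr : ∀ x ∈ Icc s₀ s₁,
      spfl (fun y => D (x, y)) t₀ t₁ = contribution (fun y => D (x, y)) t₀ t₁ μ := fun x hx =>
    spfl_eq hφ ht₀₁ ((continuousOn_right hD ⟨hs₀.trans hx.1, hx.2.trans hs₁⟩).mono
      (Icc_subset_Icc ht₀ ht₁))
      ((h (fun y => (x, y)) t₀ t₁ (by fun_prop) fun y hy => hmem x hx y hy).isSpectralFlow ht₀₁)
  have hl : ∀ y ∈ Icc t₀ t₁,
      spfl (fun x => D (x, y)) s₀ s₁ = contribution (fun x => D (x, y)) s₀ s₁ μ := fun y hy =>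
    spfl_eq hφ hs₀₁ ((continuousOn_left hD ⟨ht₀.trans hy.1, hy.2.trans ht₁⟩).mono
      (Icc_subset_Icc hs₀ hs₁))
      ((h (fun x => (x, y)) s₀ s₁ (by fun_prop) fun x hx => hmem x hx y hy).isSpectralFlow hs₀₁)
  rw [boundaryFlow, hr s₀ (left_mem_Icc.2 hs₀₁), hr s₁ (right_mem_Icc.2 hs₀₁),
    hl t₀ (left_mem_Icc.2 ht₀₁), hl t₁ (right_mem_Icc.2 ht₀₁)]
  simp only [contribution]
  ring

/-- Common sides cancel when rectangles are joined, so `interval_induction` applies in each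
variable. In the inner one `δ` is part of the relation, which yields a strip around `s` valid over
all of `[a, b]`. -/
theorem boundaryFlow_eq_zero (hφ : IsCutoff φ) (hcd : c ≤ d) (hab : a ≤ b)
    (hD : ContinuousOn D (Icc c d ×ˢ Icc a b)) : boundaryFlow D c d a b = 0 := by
  refine interval_induction hcd (R := fun s₀ s₁ => boundaryFlow D s₀ s₁ a b = 0) ?_ fun s hs => ?_
  · intro s₀ s s₁ h₀ h₁ h₂ h₃ e₁ e₂
    have hl := fun y (hy : y ∈ Icc a b) => spfl_add hφ h₁ h₂
      ((continuousOn_left hD hy).mono (Icc_subset_Icc h₀ h₃))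
    rw [boundaryFlow] at e₁ e₂ ⊢
    rw [hl a (left_mem_Icc.2 hab), hl b (right_mem_Icc.2 hab)]
    linarith
  · refine interval_induction hab (R := fun t₀ t₁ => ∃ δ > 0, ∀ s₀ s₁, c ≤ s₀ → s₀ ≤ s₁ → s₁ ≤ d →
      |s₀ - s| < δ → |s₁ - s| < δ → boundaryFlow D s₀ s₁ t₀ t₁ = 0) ?_ fun t ht => ?_
    · rintro t₀ t t₁ h₀ h₁ h₂ h₃ ⟨δ₁, hδ₁, e₁⟩ ⟨δ₂, hδ₂, e₂⟩
      refine ⟨min δ₁ δ₂, lt_min hδ₁ hδ₂, fun s₀ s₁ g₀ g₁ g₂ d₀ d₁ => ?_⟩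
      have e₁ := e₁ s₀ s₁ g₀ g₁ g₂ (d₀.trans_le (min_le_left _ _)) (d₁.trans_le (min_le_left _ _))
      have e₂ := e₂ s₀ s₁ g₀ g₁ g₂ (d₀.trans_le (min_le_right _ _)) (d₁.trans_le (min_le_right _ _))
      have hr := fun x (hx : x ∈ Icc c d) => spfl_add hφ h₁ h₂
        ((continuousOn_right hD hx).mono (Icc_subset_Icc h₀ h₃))
      rw [boundaryFlow] at e₁ e₂ ⊢
      rw [hr s₀ ⟨g₀, g₁.trans g₂⟩, hr s₁ ⟨g₀.trans g₁, g₂⟩]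
      linarith
    · obtain ⟨δ, hδ, h⟩ := exists_boundaryFlow_eq_zero hφ hD hs ht
      exact ⟨δ, hδ, fun t₀ t₁ a₀ a₁ a₂ d₀ d₁ => ⟨δ, hδ, fun s₀ s₁ g₀ g₁ g₂ d₂ d₃ =>
        h s₀ s₁ t₀ t₁ g₀ g₁ g₂ a₀ a₁ a₂ d₂ d₃ d₀ d₁⟩⟩

end SpectralFlow

end

/-! ### The proposition -/

theorem mainTheorem2 {H : Type*} [NormedAddCommGroup H] [InnerProductSpace ℂ H] [CompleteSpace H]
    [TopologicalSpace.SeparableSpace H] (φ : ℝ → ℝ) (hφ : SpectralFlow.IsCutoff φ)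
    (a b : ℝ) (hab : a ≤ b) :
    -- the spectral flow of a continuous path is well defined
    (∀ P : ℝ → SpectralFlow.FredholmSpace φ H, ContinuousOn P (Set.Icc a b) →
      ∃! N : ℤ, SpectralFlow.IsSpectralFlow P a b N) ∧
    ∀ D : ℝ × ℝ → SpectralFlow.FredholmSpace φ H,
      ContinuousOn D (Set.Icc (0 : ℝ) 1 ×ˢ Set.Icc a b) →
      -- the spectral flows around the boundary of the rectangle add up to zero
      (SpectralFlow.spfl (fun t => D (0, t)) a b + SpectralFlow.spfl (fun s => D (s, b)) 0 1
          - SpectralFlow.spfl (fun t => D (1, t)) a b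
          - SpectralFlow.spfl (fun s => D (s, a)) 0 1 = 0) ∧
      -- homotopy invariance for paths with invertible endpoints
      ((∀ s ∈ Set.Icc (0 : ℝ) 1, (D (s, a)).1.IsInvertible ∧ (D (s, b)).1.IsInvertible) →
        SpectralFlow.spfl (fun t => D (0, t)) a b = SpectralFlow.spfl (fun t => D (1, t)) a b) ∧
      -- homotopy invariance for loops
      ((∀ s ∈ Set.Icc (0 : ℝ) 1, D (s, a) = D (s, b)) →
        SpectralFlow.spfl (fun t => D (0, t)) a b = SpectralFlow.spfl (fun t => D (1, t)) a b) := by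
  refine ⟨fun P hP => SpectralFlow.existsUnique_isSpectralFlow hφ hab hP, fun D hD => ?_⟩
  have hb := SpectralFlow.continuousOn_left hD (Set.right_mem_Icc.2 hab)
  have ha := SpectralFlow.continuousOn_left hD (Set.left_mem_Icc.2 hab)
  have key := SpectralFlow.boundaryFlow_eq_zero hφ zero_le_one hab hD
  rw [SpectralFlow.boundaryFlow] at key
  refine ⟨key, fun h => ?_, fun h => ?_⟩
  · rw [SpectralFlow.spfl_eq_zero hφ zero_le_one hb fun s hs => (h s hs).2,
      SpectralFlow.spfl_eq_zero hφ zero_le_one ha fun s hs => (h s hs).1] at key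
    linarith
  · rw [SpectralFlow.spfl_congr hφ zero_le_one ha fun s hs => h s hs] at key
    linarith
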